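/- Conventions. An additive category $\mathcal{E}$ is *of finite type* if there is an object $G$ such that every object of $\mathcal{E}$ is a direct summand of a finite direct sum of copies of $G$. It is *Krull–Schmidt* if every object is a finite direct sum of objects with local endomorphism rings. A morphism $f\colon X\to Y$ is in the *radical* if $1_X-gf$ is invertible for every $g\colon Y\to X$. A morphism $g\colon Y\to Z$ is *right almost split* if $Z$ is indecomposable, $g$ is in the radical, and every morphism $W\to Z$ in the radical factors through $g$; *left almost split* morphisms are defined dually. Exact categories are meant in the sense of Quillen. An *AR conflation* in an exact category is a conflation $X\xrightarrow{f}Y\xrightarrow{g}Z$ with $f$ left almost split and $g$ right almost split. An object $P$ of an exact category is *projective* if every morphism from $P$ lifts along every deflation, and there are *enough projectives* if every object admits a deflation from a projective object. A right $\mathcal{E}$-module is an additive functor $\mathcal{E}^{\mathrm{op}}\to\mathcal{A}b$; these form the abelian category $\operatorname{Mod}\mathcal{E}$. A right $\mathcal{E}$-module $M$ is *effaceable* if there is a deflation $f\colon Y\to Z$ in $\mathcal{E}$ and an exact sequence $\mathcal{E}(-,Y)\xrightarrow{\mathcal{E}(-,f)}\mathcal{E}(-,Z)\to M\to 0$. The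 exact category $\mathcal{E}$ is *admissible* if every effaceable module has finite length in $\operatorname{Mod}\mathcal{E}$. For a Krull–Schmidt exact category $\mathcal{E}$, let $\mathsf{K}_0(\mathcal{E},0)$ be the free abelian group on the isomorphism classes of indecomposable objects of $\mathcal{E}$, and for $X\in\mathcal{E}$ let $[X]\in\mathsf{K}_0(\mathcal{E},0)$ be the sum of the classes of the indecomposable summands, with multiplicity, of $X$. Let $\mathsf{Ex}(\mathcal{E})$ (resp. $\mathsf{AR}(\mathcal{E})$) be the subgroup of $\mathsf{K}_0(\mathcal{E},0)$ generated by all $[X]-[Y]+[Z]$ for which there is a conflation (resp. an AR conflation) $X\to Y\to Z$ in $\mathcal{E}$. **Corollary 4.3.** Let $R$ be a complete noetherian commutative local ring and let $\mathcal{E}$ be an idempotent complete exact category which is $R$-linear and such that $\mathcal{E}(X,Y)$ is a finitely generated $R$-module for all $X,Y\in\mathcal{E}$. Suppose that $\mathcal{E}$ has enough projectives and is of finite type. Then $\mathcal{E}$ is Krull–Schmidt and admissible, and $\mathsf{AR}(\mathcal{E})=\mathsf{Ex}(\mathcal{E})$. -/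

import Mathlib

open CategoryTheory CategoryTheory.Limits

universe v u

noncomputable section

namespace ExactCat

section ExactStructures

variable {E : Type u} [Category.{v} E] [Preadditive E]

/-- With respect to a class `C` of short complexes, `i` is an inflation (admissible monomorphism)
if it is the first morphism of a member of `C`. -/
def InflationOf (C : ShortComplex E → Prop) {X Y : E} (i : X ⟶ Y) : Prop :=
  ∃ (Z : E) (p : Y ⟶ Z) (w : i ≫ p = 0), C (ShortComplex.mk i p w)

/-- With respect to a class `C` of short complexes, `p` is a deflation (admissible epimorphism)
if it is the second morphism of a member of `C`. -/
def DeflationOf (C : ShortComplex E → Prop) {Y Z : E} (p : Y ⟶ Z) : Prop :=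
  ∃ (X : E) (i : X ⟶ Y) (w : i ≫ p = 0), C (ShortComplex.mk i p w)

variable (E) in
/-- A Quillen exact structure on the additive category `E`: a class of kernel-cokernel pairs, the
conflations, closed under isomorphism and satisfying the axioms (E0), (E1), (E2) and their duals. -/
structure ExactStructure where
  /-- The conflations `X ↣ Y ↠ Z`. -/
  Conflation : ShortComplex E → Prop
  of_iso : ∀ {S T : ShortComplex E}, (S ≅ T) → Conflation S → Conflation T
  isKernel : ∀ {S : ShortComplex E}, Conflation S →
    Nonempty (IsLimit (KernelFork.ofι S.f S.zero))
  isCokernel : ∀ {S : ShortComplex E}, Conflation S →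
    Nonempty (IsColimit (CokernelCofork.ofπ S.g S.zero))
  inflation_id : ∀ X : E, InflationOf Conflation (𝟙 X)
  deflation_id : ∀ X : E, DeflationOf Conflation (𝟙 X)
  inflation_comp : ∀ {X Y Z : E} (i : X ⟶ Y) (j : Y ⟶ Z),
    InflationOf Conflation i → InflationOf Conflation j → InflationOf Conflation (i ≫ j)
  deflation_comp : ∀ {X Y Z : E} (p : X ⟶ Y) (q : Y ⟶ Z),
    DeflationOf Conflation p → DeflationOf Conflation q → DeflationOf Conflation (p ≫ q)
  inflation_pushout : ∀ {X Y X' : E} (i : X ⟶ Y) (a : X ⟶ X'), InflationOf Conflation i →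
    ∃ (Y' : E) (b : Y ⟶ Y') (i' : X' ⟶ Y'), IsPushout i a b i' ∧ InflationOf Conflation i'
  deflation_pullback : ∀ {Y Z Z' : E} (p : Y ⟶ Z) (c : Z' ⟶ Z), DeflationOf Conflation p →
    ∃ (Y' : E) (b : Y' ⟶ Y) (p' : Y' ⟶ Z'), IsPullback b p' p c ∧ DeflationOf Conflation p'

namespace ExactStructure

variable (𝒮 : ExactStructure E)

/-- Deflations of an exact structure. -/
def Deflation {Y Z : E} (p : Y ⟶ Z) : Prop := DeflationOf 𝒮.Conflation p

/-- `P` is projective if every morphism from `P` lifts along every deflation. -/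
def IsProjective (P : E) : Prop :=
  ∀ ⦃Y Z : E⦄ (p : Y ⟶ Z), 𝒮.Deflation p → ∀ h : P ⟶ Z, ∃ k : P ⟶ Y, k ≫ p = h

/-- Every object admits a deflation from a projective object. -/
def HasEnoughProjectives : Prop :=
  ∀ X : E, ∃ (P : E) (p : P ⟶ X), 𝒮.IsProjective P ∧ 𝒮.Deflation p

/-- A right `E`-module `M` (an additive functor `Eᵒᵖ ⥤ Ab`) is effaceable if there are a deflation
`f : Y ↠ Z` and an exact sequence `E(-, Y) ⟶ E(-, Z) ⟶ M ⟶ 0`, the first map being `E(-, f)`.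
Exactness of sequences of modules is pointwise. -/
def Effaceable (M : Eᵒᵖ ⥤+ AddCommGrpCat.{v}) : Prop :=
  ∃ (Y Z : E) (f : Y ⟶ Z) (π : preadditiveYoneda.obj Z ⟶ M.obj), 𝒮.Deflation f ∧
    ∀ W : Eᵒᵖ, Function.Exact ((preadditiveYoneda.map f).app W) (π.app W) ∧
      Function.Surjective (π.app W)

end ExactStructure

end ExactStructures

/-- An object has finite length if it has a composition series: a finite chain of subobjects
from the least to the greatest one, each of which is covered by the next. -/
def HasFiniteLength {C : Type*} [Category* C] (M : C) : Prop :=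
  ∃ (n : ℕ) (F : ℕ → Subobject M), IsBot (F 0) ∧ IsTop (F n) ∧ ∀ i < n, F i ⋖ F (i + 1)

/-- An exact category `E` is admissible if every effaceable `E`-module has finite length in the
category of all right `E`-modules. -/
def ExactStructure.Admissible {E : Type u} [Category.{v} E] [Preadditive E]
    (𝒮 : ExactStructure E) : Prop :=
  ∀ M : Eᵒᵖ ⥤+ AddCommGrpCat.{v}, 𝒮.Effaceable M → HasFiniteLength M

section AdditiveCategories

attribute [local instance] hasBinaryBiproducts_of_finite_biproducts

variable (E : Type u) [Category.{v} E] [Preadditive E] [HasFiniteBiproducts E]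

/-- There is an object `G` such that every object is a direct summand of some `G ⊕ ⋯ ⊕ G`. -/
def IsOfFiniteType : Prop :=
  ∃ G : E, ∀ X : E, ∃ (n : ℕ) (Y : E), Nonempty (X ⊞ Y ≅ ⨁ fun _ : Fin n => G)

/-- Every object is a finite direct sum of objects with local endomorphism rings. -/
def IsKrullSchmidt : Prop :=
  ∀ X : E, ∃ (n : ℕ) (Y : Fin n → E), (∀ i, IsLocalRing (End (Y i))) ∧ Nonempty (X ≅ ⨁ Y)

/-- Indecomposable objects, identified when they are isomorphic. -/
instance indSetoid : Setoid {X : E // Indecomposable X} where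
  r X Y := Nonempty (X.1 ≅ Y.1)
  iseqv := ⟨fun _ => ⟨Iso.refl _⟩, fun ⟨e⟩ => ⟨e.symm⟩, fun ⟨e⟩ ⟨e'⟩ => ⟨e ≪≫ e'⟩⟩

/-- The collection of isomorphism classes of indecomposable objects. -/
abbrev Ind := Quotient (indSetoid E)

/-- The free abelian group `K₀(E, 0)` on the isomorphism classes of indecomposable objects. -/
abbrev SplitK₀ := Ind E →₀ ℤ

variable {E}

/-- `x` is the sum of the classes of the summands in some decomposition of `X` into a finite
direct sum of indecomposable objects. -/
def HasClass (X : E) (x : SplitK₀ E) : Prop :=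
  ∃ (n : ℕ) (Y : Fin n → {X : E // Indecomposable X}),
    Nonempty (X ≅ ⨁ fun i => (Y i).1) ∧
      x = ∑ i, Finsupp.single (Quotient.mk (indSetoid E) (Y i) : Ind E) (1 : ℤ)

open Classical in
/-- The class `[X] ∈ K₀(E, 0)`: the sum of the classes of the indecomposable summands of `X`.
In a Krull-Schmidt category, `X` has a decomposition into indecomposables and it is unique up to
isomorphism and permutation, so that `[X]` does not depend on the choice made here. -/
def cls (X : E) : SplitK₀ E :=
  if h : ∃ x, HasClass X x then h.choose else 0

/-- The morphism `f` belongs to the Jacobson radical of the category. -/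
def InRadical {X Y : E} (f : X ⟶ Y) : Prop :=
  ∀ g : Y ⟶ X, IsIso (𝟙 X - f ≫ g)

/-- `g : Y ⟶ Z` is right almost split. -/
def RightAlmostSplit {Y Z : E} (g : Y ⟶ Z) : Prop :=
  Indecomposable Z ∧ InRadical g ∧
    ∀ ⦃W : E⦄ (h : W ⟶ Z), InRadical h → ∃ k : W ⟶ Y, k ≫ g = h

/-- `f : X ⟶ Y` is left almost split. -/
def LeftAlmostSplit {X Y : E} (f : X ⟶ Y) : Prop :=
  Indecomposable X ∧ InRadical f ∧
    ∀ ⦃W : E⦄ (h : X ⟶ W), InRadical h → ∃ k : Y ⟶ W, f ≫ k = h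

namespace ExactStructure

variable (𝒮 : ExactStructure E)

/-- Auslander-Reiten conflations. -/
def ARConflation (S : ShortComplex E) : Prop :=
  𝒮.Conflation S ∧ LeftAlmostSplit S.f ∧ RightAlmostSplit S.g

/-- The subgroup of `K₀(E, 0)` generated by `[X] - [Y] + [Z]` for all conflations
`X ↣ Y ↠ Z`. -/
def Ex : AddSubgroup (SplitK₀ E) :=
  AddSubgroup.closure
    {x | ∃ S : ShortComplex E, 𝒮.Conflation S ∧ x = cls S.X₁ - cls S.X₂ + cls S.X₃}

/-- The subgroup of `K₀(E, 0)` generated by `[X] - [Y] + [Z]` for all AR conflations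
`X ↣ Y ↠ Z`. -/
def AR : AddSubgroup (SplitK₀ E) :=
  AddSubgroup.closure
    {x | ∃ S : ShortComplex E, 𝒮.ARConflation S ∧ x = cls S.X₁ - cls S.X₂ + cls S.X₃}

end ExactStructure

end AdditiveCategories

/-- All morphism modules of the `R`-linear category `E` are finitely generated. -/
def HomNoetherian (R : Type*) [CommRing R] (E : Type u) [Category.{v} E] [Preadditive E]
    [Linear R E] : Prop :=
  ∀ X Y : E, Module.Finite R (X ⟶ Y)

end ExactCat

end

/-! ### Finite algebras over complete local rings -/

section CompleteLocal

open IsLocalRing TensorProduct Polynomial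

/-! Krull–Schmidt: idempotents lift in finite algebras over `R`, so an endomorphism ring with only
trivial idempotents is local. Decomposing an object stops because the dimension of `k ⊗ Hom(G, X)`,
for `k` the residue field and `G` an additive generator, is additive in `X` and positive on nonzero
objects.

The rest hinges on `exists_submodule_le_iff`. Let `X ⟶ Y ⟶ Z` be a conflation with deflation `p`,
and `M` the cokernel of `E(-, p)`. Send `c : W ⟶ Z` to the submodule of `Hom(X, G)` of morphisms
that extend to the pullback of `Y` along `c`. This embeds the submodules of `M` generated by one
such `c`, with order reversed, into the submodules of a noetherian module. Finite type makes every
submodule of `M` of this form (`exists_generating_morphism`), so descending chains stop; ascending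
chains stop because `Hom(G, Z)` is noetherian. Hence `M` has finite length.

For `AR = Ex`, let `p` be non-split, and let `c : W ⟶ Z` generate a simple submodule of `M`. Pulling
back along `c` gives `X ⟶ V ⟶ W`, with simple cokernel, and `V ⟶ Y ⊞ W ⟶ Z`, with strictly larger
image in `Hom(G, Z)`. The alternating sum of the original conflation is the sum of these two, so
noetherian induction leaves only simple cokernels. For those, a pullback and a pushout with split
squares make both ends indecomposable, and the result is an AR conflation. -/

theorem IsPrecomplete.of_finite {R : Type*} [CommRing R] (I : Ideal R) [IsPrecomplete I R]
    (M : Type*) [AddCommGroup M] [Module R M] [Module.Finite R M] : IsPrecomplete I M := by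
  rw [← AdicCompletion.of_surjective_iff]
  intro y
  obtain ⟨t, rfl⟩ := AdicCompletion.ofTensorProduct_surjective_of_finite I M y
  induction t with
  | zero => exact ⟨0, by simp⟩
  | tmul r x =>
    obtain ⟨r, rfl⟩ := AdicCompletion.of_surjective I R r
    refine ⟨r • x, ?_⟩
    rw [AdicCompletion.ofTensorProduct_tmul]
    ext n
    simp [AdicCompletion.smul_eval]
    rfl
  | add a b ha hb =>
    obtain ⟨a', ha⟩ := ha
    obtain ⟨b', hb⟩ := hb
    exact ⟨a' + b', by rw [map_add, map_add, ha, hb]⟩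

theorem isAdicComplete_map_maximalIdeal (R : Type*) [CommRing R] [IsLocalRing R]
    [IsNoetherianRing R] [IsAdicComplete (maximalIdeal R) R] (A : Type*) [CommRing A] [Algebra R A]
    [Module.Finite R A] : IsAdicComplete ((maximalIdeal R).map (algebraMap R A)) A := by
  rw [IsAdicComplete.map_algebraMap_iff]
  have := IsPrecomplete.of_finite (maximalIdeal R) A
  exact { }

/-- In a commutative algebra which is finite over a complete noetherian local ring, an element `a`
is a unit, or `1 - a` is, or there is a non-trivial idempotent. -/
theorem isUnit_or_isUnit_one_sub_of_finite (R : Type*) [CommRing R] [IsLocalRing R]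
    [IsNoetherianRing R] [IsAdicComplete (maximalIdeal R) R] {A : Type*} [CommRing A] [Algebra R A]
    [Module.Finite R A] (hA : ∀ e : A, e * e = e → e = 0 ∨ e = 1) (a : A) :
    IsUnit a ∨ IsUnit (1 - a) := by
  have := isAdicComplete_map_maximalIdeal R A
  set J := (maximalIdeal R).map (algebraMap R A) with hJ
  have hJac : J ≤ (⊥ : Ideal A).jacobson := IsAdicComplete.le_jacobson_bot J
  have hunit (x : A) (hx : IsUnit (Ideal.Quotient.mk J x)) : IsUnit x := by
    obtain ⟨y, hy⟩ := hx.exists_right_inv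
    obtain ⟨y, rfl⟩ := Ideal.Quotient.mk_surjective y
    rw [← map_mul, ← map_one (Ideal.Quotient.mk J), Ideal.Quotient.mk_eq_mk_iff_sub_mem] at hy
    have h := Ideal.mem_jacobson_bot.1 (hJac hy) 1
    rw [mul_one, sub_add_cancel] at h
    exact isUnit_of_mul_isUnit_left h
  let k := ResidueField R
  let : Algebra k (A ⧸ J) :=
    (Ideal.Quotient.lift (maximalIdeal R) (algebraMap R (A ⧸ J)) fun r hr => by
      rw [IsScalarTower.algebraMap_apply R A, Ideal.Quotient.algebraMap_eq]
      exact Ideal.Quotient.eq_zero_iff_mem.2 (Ideal.mem_map_of_mem _ hr)).toAlgebra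
  have : IsScalarTower R k (A ⧸ J) := IsScalarTower.of_algebraMap_eq fun r => rfl
  have : Module.Finite R (A ⧸ J) :=
    Module.Finite.of_surjective (Ideal.Quotient.mkₐ R J).toLinearMap Ideal.Quotient.mk_surjective
  have : Module.Finite k (A ⧸ J) := Module.Finite.of_restrictScalars_finite R k _
  have : IsArtinianRing (A ⧸ J) := IsArtinianRing.of_finite k _
  have hlift (b : A ⧸ J) (hb : b * b = b) : b = 0 ∨ b = 1 := by
    obtain ⟨b, rfl⟩ := Ideal.Quotient.mk_surjective b
    obtain ⟨e, he, heb⟩ := HenselianRing.is_henselian (I := J) (X ^ 2 - X : A[X])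
      (by monicity!) b
      (by simpa [sq, Ideal.Quotient.mk_eq_mk_iff_sub_mem, ← map_mul] using
            (Ideal.Quotient.mk_eq_mk_iff_sub_mem _ _).1 ((map_mul _ b b).trans hb))
      (by
        -- The derivative `2b - 1` of `X ^ 2 - X` is its own inverse at an idempotent `b`.
        refine IsUnit.of_mul_eq_one (2 * Ideal.Quotient.mk J b - 1) ?_
        simp only [derivative_X_pow, derivative_X, eval_sub, eval_mul, eval_pow,
          eval_X, eval_one, map_sub, map_mul, map_one]
        norm_num [show Ideal.Quotient.mk J 2 = 2 from map_ofNat _ 2]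
        linear_combination 4 * hb)
    rw [← Ideal.Quotient.mk_eq_mk_iff_sub_mem] at heb
    rw [← heb]
    rcases hA e (by simpa [sub_eq_zero, sq] using he) with rfl | rfl <;> simp
  -- Fitting's argument: once `b ^ n = b ^ (n + 1) * y`, the element `b ^ n * y ^ n` is idempotent.
  -- If it is `0`, then `b` is nilpotent; if it is `1`, then `b` is a unit. For `n = 0` the
  -- idempotent carries no information, and `b * y = 1` is used directly.
  have hart (b : A ⧸ J) : IsUnit b ∨ IsUnit (1 - b) := by
    obtain ⟨n, y, hy⟩ := IsArtinian.exists_pow_succ_smul_dvd b (1 : A ⧸ J)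
    simp only [smul_eq_mul, mul_one] at hy
    have key (m : ℕ) : b ^ (n + m) * y ^ m = b ^ n := by
      induction m with
      | zero => simp
      | succ m ih =>
        calc b ^ (n + (m + 1)) * y ^ (m + 1) = (b ^ (n + 1) * y) * (b ^ m * y ^ m) := by ring
          _ = b ^ (n + m) * y ^ m := by rw [show b ^ (n + 1) * y = b ^ n from hy]; ring
          _ = b ^ n := ih
    have key' : b ^ n * (b ^ n * y ^ n) = b ^ n := by
      rw [← mul_assoc, ← pow_add]; exact key n
    rcases hlift (b ^ n * y ^ n) (by linear_combination y ^ n * key') with h | h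
    · right
      rw [h, mul_zero] at key'
      exact IsNilpotent.isUnit_one_sub ⟨n, key'.symm⟩
    · rcases n with _ | n
      · left
        exact IsUnit.of_mul_eq_one y (by simpa using hy)
      · left
        exact IsUnit.of_mul_eq_one (b ^ n * y ^ (n + 1)) (by rw [← h]; ring)
  rcases hart (Ideal.Quotient.mk J a) with h | h
  · exact Or.inl (hunit _ h)
  · exact Or.inr (hunit _ (by simpa using h))

/-- An algebra which is finite over a complete noetherian local ring is local if it has no
non-trivial idempotents. -/
theorem isLocalRing_of_finite_of_idempotents (R : Type*) [CommRing R] [IsLocalRing R]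
    [IsNoetherianRing R] [IsAdicComplete (maximalIdeal R) R] {B : Type*} [Ring B] [Nontrivial B]
    [Algebra R B] [Module.Finite R B] (hB : ∀ e : B, e * e = e → e = 0 ∨ e = 1) :
    IsLocalRing B := by
  refine IsLocalRing.of_isUnit_or_isUnit_one_sub_self fun b => ?_
  -- The commutative case applies to `R[b]`, which is finite over `R` as a submodule of the
  -- noetherian module `B`.
  let φ : R[X] →ₐ[R] B := aeval b
  let A := R[X] ⧸ RingHom.ker φ
  let ψ : A →ₐ[R] B := Ideal.kerLiftAlg φ
  have hψ : Function.Injective ψ := Ideal.kerLiftAlg_injective φ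
  have : IsNoetherian R B := isNoetherian_of_isNoetherianRing_of_finite R B
  have : Module.Finite R A := Module.Finite.of_injective ψ.toLinearMap hψ
  let a : A := Ideal.Quotient.mk _ X
  have ha : ψ a = b := by
    change aeval b X = b
    exact aeval_X b
  rcases isUnit_or_isUnit_one_sub_of_finite R (A := A) (fun e he => by
    rcases hB (ψ e) (by rw [← map_mul, he]) with h | h
    · exact Or.inl (hψ (by rw [h, map_zero]))
    · exact Or.inr (hψ (by rw [h, map_one]))) a with h | h
  · exact Or.inl (ha ▸ h.map ψ)
  · exact Or.inr (by simpa [ha] using h.map ψ)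

end CompleteLocal

namespace ExactCat

attribute [local instance] hasBinaryBiproducts_of_finite_biproducts

/-! ### Retracts and local endomorphism rings -/

section Retracts

variable {E : Type u} [Category.{v} E] [Preadditive E]

theorem isZero_of_retract {C B : E} (hB : IsZero B) (i : C ⟶ B) (r : B ⟶ C) (h : i ≫ r = 𝟙 C) :
    IsZero C := by
  rw [IsZero.iff_id_eq_zero, ← h, hB.eq_of_tgt i 0, zero_comp]

theorem isIso_or_isIso_of_add_eq_id {C : E} (hC : IsLocalRing (End C)) {a b : C ⟶ C}
    (h : a + b = 𝟙 C) : IsIso a ∨ IsIso b := by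
  rcases IsLocalRing.isUnit_or_isUnit_of_add_one (R := End C) (a := a) (b := b) h with h | h
  · exact Or.inl ((isUnit_iff_isIso _).1 h)
  · exact Or.inr ((isUnit_iff_isIso _).1 h)

end Retracts

/-! ### Unique decomposition into indecomposables -/

section KrullSchmidt

variable {E : Type u} [Category.{v} E] [Preadditive E] [HasFiniteBiproducts E]

/-- In an idempotent complete category a retract is a direct summand. -/
theorem exists_iso_biprod_of_retract [IsIdempotentComplete E] {C B : E} (i : C ⟶ B) (r : B ⟶ C)
    (h : i ≫ r = 𝟙 C) :
    ∃ (B' : E) (e : B ≅ C ⊞ B'), e.hom ≫ biprod.fst = r ∧ biprod.inl ≫ e.inv = i := by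
  obtain ⟨B', j, t, hjt, htj⟩ := IsIdempotentComplete.idempotents_split B (𝟙 B - r ≫ i)
    (by simp [reassoc_of% h])
  have hit : i ≫ t = 0 := by
    have : i ≫ (t ≫ j) ≫ t = 0 := by rw [htj]; simp [reassoc_of% h]
    simpa [hjt] using this
  have hjr : j ≫ r = 0 := by
    have : j ≫ (t ≫ j) ≫ r = 0 := by rw [htj]; simp [h]
    simpa [reassoc_of% hjt] using this
  refine ⟨B', ⟨biprod.lift r t, biprod.desc i j, ?_, ?_⟩, by simp, by simp⟩
  · rw [biprod.lift_desc, htj]; abel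
  · ext <;> simp [h, hit, hjr, hjt]

theorem isZero_of_iso_biprod_left {X A B : E} (hX : IsZero X) (e : X ≅ A ⊞ B) : IsZero A :=
  isZero_of_retract hX (biprod.inl ≫ e.inv) (e.hom ≫ biprod.fst) (by simp)

/-- A nonzero direct summand of an indecomposable object is everything. -/
theorem comp_eq_id_of_indecomposable [IsIdempotentComplete E] {C D : E} (hC : ¬ IsZero C)
    (hD : Indecomposable D) (i : C ⟶ D) (r : D ⟶ C) (h : i ≫ r = 𝟙 C) : r ≫ i = 𝟙 D := by
  obtain ⟨B', e, rfl, rfl⟩ := exists_iso_biprod_of_retract i r h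
  have hB' : IsZero B' := (hD.2 _ _ e).resolve_left hC
  have h2 : (biprod.snd : C ⊞ B' ⟶ B') ≫ (biprod.inr : B' ⟶ C ⊞ B') = 0 := by
    rw [hB'.eq_of_src (biprod.inr : B' ⟶ C ⊞ B') 0, comp_zero]
  have h3 := biprod.total (X := C) (Y := B')
  rw [h2, add_zero] at h3
  calc _ = e.hom ≫ (biprod.fst ≫ biprod.inl) ≫ e.inv := by simp
    _ = 𝟙 D := by rw [h3]; simp

theorem isIso_of_indecomposable [IsIdempotentComplete E] {C D : E} (hC : ¬ IsZero C)
    (hD : Indecomposable D) (i : C ⟶ D) (r : D ⟶ C) (h : IsIso (i ≫ r)) : IsIso i :=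
  ⟨r ≫ inv (i ≫ r), by rw [← Category.assoc, IsIso.hom_inv_id],
    comp_eq_id_of_indecomposable hC hD i _ (by rw [← Category.assoc, IsIso.hom_inv_id])⟩

theorem isLocalRing_end_of_indecomposable (R : Type*) [CommRing R] [IsLocalRing R]
    [IsNoetherianRing R] [IsAdicComplete (IsLocalRing.maximalIdeal R) R] [Linear R E]
    [IsIdempotentComplete E] (hNoeth : HomNoetherian R E) {C : E} (hC : Indecomposable C) :
    IsLocalRing (End C) := by
  have : Module.Finite R (End C) := hNoeth C C
  have : Nontrivial (End C) := ⟨𝟙 C, 0, fun h => hC.1 ((IsZero.iff_id_eq_zero C).2 h)⟩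
  refine isLocalRing_of_finite_of_idempotents R fun e he => ?_
  obtain ⟨A, j, t, hjt, htj⟩ := IsIdempotentComplete.idempotents_split C e he
  by_cases hA : IsZero A
  · left
    rw [← htj, hA.eq_of_src j 0, comp_zero]
  · right
    rw [← htj]
    exact comp_eq_id_of_indecomposable hA hC j t hjt

/-- Exchange of the first two summands of a threefold biproduct. -/
@[simps]
noncomputable def biprodExchange (D C B : E) : D ⊞ (C ⊞ B) ≅ C ⊞ (D ⊞ B) where
  hom := biprod.lift (biprod.snd ≫ biprod.fst) (biprod.lift biprod.fst (biprod.snd ≫ biprod.snd))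
  inv := biprod.lift (biprod.snd ≫ biprod.fst) (biprod.lift biprod.fst (biprod.snd ≫ biprod.snd))

@[simps]
noncomputable def isoBiprodOfIsZero {X A : E} (hA : IsZero A) : X ≅ X ⊞ A where
  hom := biprod.inl
  inv := biprod.fst
  inv_hom_id := by
    rw [← biprod.total, hA.eq_of_src biprod.inr 0]; simp

@[simps]
noncomputable def biproductSuccIso {n : ℕ} (Y : Fin (n + 1) → E) :
    ⨁ Y ≅ Y 0 ⊞ ⨁ fun i : Fin n => Y i.succ where
  hom := biprod.lift (biproduct.π Y 0) (biproduct.lift fun j => biproduct.π Y j.succ)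
  inv := biprod.desc (biproduct.ι Y 0) (biproduct.desc fun j => biproduct.ι Y j.succ)
  hom_inv_id := by
    rw [biprod.lift_desc, biproduct.lift_desc, ← biproduct.total, Fin.sum_univ_succ]
  inv_hom_id := by
    ext i j
    · simp
    · simp [biproduct.ι_π_ne _ (Fin.succ_ne_zero _).symm]
    · simp [biproduct.ι_π_ne _ (Fin.succ_ne_zero _)]
    · by_cases h : i = j
      · subst h; simp
      · simp [biproduct.ι_π_ne _ h, biproduct.ι_π_ne _ (Fin.succ_injective _ |>.ne h)]

/-- `x` is the class of an iterated biproduct of indecomposable objects isomorphic to `X`. -/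
inductive Decomposition : E → SplitK₀ E → Prop
  | zero {X : E} (h : IsZero X) : Decomposition X 0
  | cons {X A : E} (C : {X : E // Indecomposable X}) {a : SplitK₀ E} (e : X ≅ C.1 ⊞ A)
      (h : Decomposition A a) : Decomposition X (Finsupp.single (Quotient.mk (indSetoid E) C) 1 + a)

theorem Decomposition.of_iso {X Y : E} {x : SplitK₀ E} (h : Decomposition X x) (e : Y ≅ X) :
    Decomposition Y x := by
  cases h with
  | zero h => exact .zero (h.of_iso e)
  | cons C e' h => exact .cons C (e ≪≫ e') h

/-- The exchange property behind uniqueness. The identity of `C` is the sum of its paths through the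
first summand `D` and the remainder `B`; since `End C` is local, one of the two is invertible. -/
theorem Decomposition.exists_of_iso_biprod [IsIdempotentComplete E]
    (hloc : ∀ C : E, Indecomposable C → IsLocalRing (End C)) {X : E} {x : SplitK₀ E}
    (h : Decomposition X x) (C : {X : E // Indecomposable X}) {A : E} (e : X ≅ C.1 ⊞ A) :
    ∃ a, Decomposition A a ∧ x = Finsupp.single (Quotient.mk (indSetoid E) C) 1 + a := by
  induction h generalizing A with
  | zero h => exact absurd (isZero_of_iso_biprod_left h e) C.2.1
  | @cons X B D b e' hB ih =>
    let u : C.1 ⟶ D.1 ⊞ B := biprod.inl ≫ e.inv ≫ e'.hom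
    let w : D.1 ⊞ B ⟶ C.1 := e'.inv ≫ e.hom ≫ biprod.fst
    have huw : (u ≫ biprod.fst) ≫ biprod.inl ≫ w + (u ≫ biprod.snd) ≫ biprod.inr ≫ w = 𝟙 C.1 := by
      calc _ = u ≫ (biprod.fst ≫ biprod.inl + biprod.snd ≫ biprod.inr) ≫ w := by
            simp only [Preadditive.add_comp, Preadditive.comp_add, Category.assoc]
        _ = 𝟙 C.1 := by rw [biprod.total]; simp [u, w]
    rcases isIso_or_isIso_of_add_eq_id (hloc _ C.2) huw with h | h
    · have hiso := isIso_of_indecomposable C.2.1 D.2 _ _ h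
      have : IsIso (biprod.inl ≫ (e.symm ≪≫ e').hom ≫ biprod.fst) := by
        simpa [u] using hiso
      refine ⟨b, hB.of_iso (Biprod.isoElim (e.symm ≪≫ e')), ?_⟩
      congr 2
      exact Quotient.sound ⟨(asIso (u ≫ biprod.fst)).symm⟩
    -- Here `C` splits off `B`, say `B ≅ C ⊞ B'`. The retraction is normalised so that the component
    -- `C ⟶ C` of `g` is the identity; eliminating it leaves `A ≅ D ⊞ B'`.
    · set i := u ≫ biprod.snd with hi
      obtain ⟨B', eB, hr, -⟩ := exists_iso_biprod_of_retract i
        ((biprod.inr ≫ w) ≫ inv (i ≫ biprod.inr ≫ w)) (by rw [← Category.assoc, IsIso.hom_inv_id])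
      obtain ⟨b', hb', rfl⟩ := ih eB
      let g : C.1 ⊞ A ≅ C.1 ⊞ (D.1 ⊞ B') :=
        e.symm ≪≫ e' ≪≫ biprod.mapIso (Iso.refl _) eB ≪≫ biprodExchange _ _ _
      have hg : biprod.inl ≫ g.hom ≫ biprod.fst = 𝟙 C.1 := by
        have : biprod.inl ≫ g.hom ≫ biprod.fst = i ≫ eB.hom ≫ biprod.fst := by
          simp [g, hi, u]
        rw [this, hr, ← Category.assoc, IsIso.hom_inv_id]
      have : IsIso (biprod.inl ≫ g.hom ≫ biprod.fst) := by rw [hg]; infer_instance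
      exact ⟨_, .cons D (Biprod.isoElim g) hb', by abel⟩

theorem Decomposition.unique [IsIdempotentComplete E]
    (hloc : ∀ C : E, Indecomposable C → IsLocalRing (End C)) {X : E} {x y : SplitK₀ E}
    (hx : Decomposition X x) (hy : Decomposition X y) : x = y := by
  induction hx generalizing y with
  | zero h =>
    cases hy with
    | zero => rfl
    | cons C e h' => exact absurd (isZero_of_iso_biprod_left h e) C.2.1
  | cons C e h ih =>
    obtain ⟨a, ha, rfl⟩ := hy.exists_of_iso_biprod hloc C e
    rw [ih ha]

theorem Decomposition.biprod {X Y Z : E} {x y : SplitK₀ E} (hx : Decomposition X x)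
    (hy : Decomposition Y y) (e : Z ≅ X ⊞ Y) : Decomposition Z (x + y) := by
  induction hx generalizing Z with
  | zero h =>
    rw [zero_add]
    exact hy.of_iso (e ≪≫ biprod.braiding _ _ ≪≫ (isoBiprodOfIsZero h).symm)
  | cons C e' h ih =>
    rw [add_assoc]
    exact .cons C (e ≪≫ biprod.mapIso e' (Iso.refl _) ≪≫ biprod.associator _ _ _)
      (ih (Iso.refl _))

theorem hasClass_iff_decomposition {X : E} {x : SplitK₀ E} :
    HasClass X x ↔ Decomposition X x := by
  constructor
  · rintro ⟨n, Y, ⟨e⟩, rfl⟩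
    induction n generalizing X with
    | zero =>
      rw [Fin.sum_univ_zero]
      exact .zero ((IsZero.iff_id_eq_zero _).2 (by ext i; exact i.elim0) |>.of_iso e)
    | succ n ih =>
      rw [Fin.sum_univ_succ]
      exact .cons _ (e ≪≫ biproductSuccIso _) (ih (fun i => Y i.succ) (Iso.refl _))
  · intro h
    induction h with
    | zero h =>
      refine ⟨0, Fin.elim0, ⟨h.iso ((IsZero.iff_id_eq_zero _).2 (by ext i; exact i.elim0))⟩, ?_⟩
      rw [Fin.sum_univ_zero]
    | cons C e h ih =>
      obtain ⟨n, Y, ⟨e'⟩, rfl⟩ := ih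
      refine ⟨n + 1, Fin.cons C Y, ⟨e ≪≫ biprod.mapIso (Iso.refl _) e' ≪≫
        (biproductSuccIso fun i =>
          ((Fin.cons C Y : Fin (n + 1) → {X : E // Indecomposable X}) i).1).symm⟩, ?_⟩
      rw [Fin.sum_univ_succ]
      rfl

theorem Decomposition.cls_eq [IsIdempotentComplete E]
    (hloc : ∀ C : E, Indecomposable C → IsLocalRing (End C)) {X : E} {x : SplitK₀ E}
    (h : Decomposition X x) : cls X = x := by
  have hex : ∃ x, HasClass X x := ⟨x, hasClass_iff_decomposition.2 h⟩
  rw [cls, dif_pos hex]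
  exact (hasClass_iff_decomposition.1 hex.choose_spec).unique hloc h

/-- The object `G` generates `E` under finite direct sums and direct summands. -/
noncomputable def IsAdditiveGenerator (G : E) : Prop :=
  ∀ X : E, ∃ (n : ℕ) (s : Fin n → (X ⟶ G)) (r : Fin n → (G ⟶ X)), ∑ i, s i ≫ r i = 𝟙 X

theorem IsOfFiniteType.exists_generator (h : IsOfFiniteType E) :
    ∃ G : E, IsAdditiveGenerator G := by
  obtain ⟨G, hG⟩ := h
  refine ⟨G, fun X => ?_⟩
  obtain ⟨n, Y, ⟨e⟩⟩ := hG X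
  refine ⟨n, fun i => biprod.inl ≫ e.hom ≫ biproduct.π _ i,
    fun i => biproduct.ι (fun _ : Fin n => G) i ≫ e.inv ≫ biprod.fst, ?_⟩
  calc _ = biprod.inl ≫ e.hom ≫ (∑ i, biproduct.π (fun _ : Fin n => G) i ≫
        biproduct.ι (fun _ : Fin n => G) i) ≫
        e.inv ≫ biprod.fst := by
        simp only [Preadditive.comp_sum, Preadditive.sum_comp, Category.assoc]
    _ = 𝟙 X := by rw [biproduct.total]; simp

/-- Morphisms into a binary biproduct, as a product of modules. -/
noncomputable def homBiprodLinearEquiv (R : Type*) [CommRing R] [Linear R E] (G A B : E) :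
    (G ⟶ A ⊞ B) ≃ₗ[R] (G ⟶ A) × (G ⟶ B) where
  toFun f := (f ≫ biprod.fst, f ≫ biprod.snd)
  invFun f := biprod.lift f.1 f.2
  map_add' f g := by simp
  map_smul' r f := by simp
  left_inv f := by ext <;> simp
  right_inv f := by simp

open TensorProduct IsLocalRing in
theorem exists_decomposition (R : Type*) [CommRing R] [IsLocalRing R] [Linear R E]
    (hNoeth : HomNoetherian R E) {G : E} (hG : IsAdditiveGenerator G) (X : E) :
    ∃ x, Decomposition X x := by
  have hfin (X : E) : Module.Finite R (G ⟶ X) := hNoeth G X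
  have := hasZeroObject_of_hasFiniteBiproducts E
  -- If `ν X = 0`, Nakayama gives `Hom(G, X) = 0`, and then `X = 0` because `G` is a generator.
  let ν : E → ℕ := fun X => Module.finrank (ResidueField R) (ResidueField R ⊗[R] (G ⟶ X))
  have hadd {X A B : E} (e : X ≅ A ⊞ B) : ν X = ν A + ν B := by
    let e₁ : (G ⟶ X) ≃ₗ[R] (G ⟶ A) × (G ⟶ B) :=
      Linear.homCongr R (Iso.refl G) e ≪≫ₗ homBiprodLinearEquiv R G A B
    have := (e₁.baseChange R (ResidueField R) _ _ ≪≫ₗ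
      TensorProduct.prodRight R (ResidueField R) (ResidueField R) (G ⟶ A) (G ⟶ B)).finrank_eq
    rw [Module.finrank_prod] at this
    exact this
  have hpos {X : E} (hX : ¬ IsZero X) : 0 < ν X := by
    rw [Module.finrank_pos_iff]
    by_contra h
    rw [not_nontrivial_iff_subsingleton, IsLocalRing.subsingleton_tensorProduct] at h
    apply hX
    obtain ⟨n, s, r, hsr⟩ := hG X
    rw [IsZero.iff_id_eq_zero, ← hsr]
    exact Finset.sum_eq_zero fun i _ => by rw [Subsingleton.elim (r i) 0, comp_zero]
  induction hn : ν X using Nat.strong_induction_on generalizing X with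
  | _ n ih =>
    subst hn
    by_cases hX : IsZero X
    · exact ⟨_, .zero hX⟩
    by_cases hX' : Indecomposable X
    · exact ⟨_, .cons ⟨X, hX'⟩ (isoBiprodOfIsZero (isZero_zero E)) (.zero (isZero_zero E))⟩
    · simp only [Indecomposable, not_and, not_forall, not_or] at hX'
      obtain ⟨A, B, e, hA, hB⟩ := hX' hX
      have h := hadd e
      have h₁ := hpos hA
      have h₂ := hpos hB
      obtain ⟨a, ha⟩ := ih _ (by omega) A rfl
      obtain ⟨b, hb⟩ := ih _ (by omega) B rfl
      exact ⟨_, ha.biprod hb e⟩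

end KrullSchmidt

namespace ExactStructure

/-! ### Pullbacks, pushouts and splitting of conflations -/

section Basic

variable {E : Type u} [Category.{v} E] [Preadditive E] (𝒮 : ExactStructure E)

/-- `X ⟶ Y ⟶ Z` is a conflation. -/
def IsConflation {X Y Z : E} (f : X ⟶ Y) (p : Y ⟶ Z) : Prop :=
  ∃ w : f ≫ p = 0, 𝒮.Conflation (ShortComplex.mk f p w)

variable {𝒮} {X Y Z : E} {f : X ⟶ Y} {p : Y ⟶ Z}

namespace IsConflation

theorem zero (h : 𝒮.IsConflation f p) : f ≫ p = 0 := h.1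

theorem deflation (h : 𝒮.IsConflation f p) : 𝒮.Deflation p := ⟨X, f, h.1, h.2⟩

theorem inflation (h : 𝒮.IsConflation f p) : InflationOf 𝒮.Conflation f := ⟨Z, p, h.1, h.2⟩

theorem mono (h : 𝒮.IsConflation f p) : Mono f := by
  obtain ⟨w, h⟩ := h
  obtain ⟨hl⟩ := 𝒮.isKernel h
  exact mono_of_isLimit_fork hl

theorem epi (h : 𝒮.IsConflation f p) : Epi p := by
  obtain ⟨w, h⟩ := h
  obtain ⟨hl⟩ := 𝒮.isCokernel h
  exact epi_of_isColimit_cofork hl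

theorem exists_lift (h : 𝒮.IsConflation f p) {W : E} (k : W ⟶ Y) (hk : k ≫ p = 0) :
    ∃ l : W ⟶ X, l ≫ f = k := by
  obtain ⟨w, h⟩ := h
  obtain ⟨hl⟩ := 𝒮.isKernel h
  obtain ⟨l, hl⟩ := KernelFork.IsLimit.lift' hl k hk
  exact ⟨l, hl⟩

theorem exists_desc (h : 𝒮.IsConflation f p) {W : E} (k : Y ⟶ W) (hk : f ≫ k = 0) :
    ∃ l : Z ⟶ W, p ≫ l = k := by
  obtain ⟨w, h⟩ := h
  obtain ⟨hl⟩ := 𝒮.isCokernel h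
  obtain ⟨l, hl⟩ := CokernelCofork.IsColimit.desc' hl k hk
  exact ⟨l, hl⟩

/-- Any kernel of a deflation completes it to a conflation. -/
theorem of_kernel (hp : 𝒮.Deflation p) (w : f ≫ p = 0) (hf : Mono f)
    (hlift : ∀ ⦃T : E⦄ (k : T ⟶ Y), k ≫ p = 0 → ∃ l : T ⟶ X, l ≫ f = k) :
    𝒮.IsConflation f p := by
  obtain ⟨K, i, wi, hi⟩ := hp
  have hi' : 𝒮.IsConflation i p := ⟨wi, hi⟩
  have := hi'.mono
  obtain ⟨l, hl⟩ := hlift i wi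
  obtain ⟨m, hm⟩ := hi'.exists_lift f w
  refine ⟨w, 𝒮.of_iso (S := ShortComplex.mk i p wi)
    (ShortComplex.isoMk ⟨l, m, ?_, ?_⟩ (Iso.refl _) (Iso.refl _) ?_ ?_) hi⟩
  · change l ≫ m = 𝟙 K
    rw [← cancel_mono i, Category.assoc, hm, hl, Category.id_comp]
  · change m ≫ l = 𝟙 X
    rw [← cancel_mono f, Category.assoc, hl, hm, Category.id_comp]
  · simpa using hl
  · simp

/-- Any cokernel of an inflation completes it to a conflation. -/
theorem of_cokernel (hf : InflationOf 𝒮.Conflation f) (w : f ≫ p = 0) (hp : Epi p)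
    (hdesc : ∀ ⦃T : E⦄ (k : Y ⟶ T), f ≫ k = 0 → ∃ l : Z ⟶ T, p ≫ l = k) :
    𝒮.IsConflation f p := by
  obtain ⟨K, i, wi, hi⟩ := hf
  have hi' : 𝒮.IsConflation f i := ⟨wi, hi⟩
  have := hi'.epi
  obtain ⟨l, hl⟩ := hdesc i wi
  obtain ⟨m, hm⟩ := hi'.exists_desc p w
  refine ⟨w, 𝒮.of_iso (S := ShortComplex.mk f i wi)
    (ShortComplex.isoMk (Iso.refl _) (Iso.refl _) ⟨m, l, ?_, ?_⟩ ?_ ?_) hi⟩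
  · change m ≫ l = 𝟙 K
    rw [← cancel_epi i, ← Category.assoc, hm, hl, Category.comp_id]
  · change l ≫ m = 𝟙 Z
    rw [← cancel_epi p, ← Category.assoc, hl, hm, Category.comp_id]
  · simp
  · simpa using hm.symm

theorem exists_pullback (h : 𝒮.IsConflation f p) {W : E} (c : W ⟶ Z) :
    ∃ (V : E) (b : V ⟶ Y) (q : V ⟶ W) (f' : X ⟶ V),
      IsPullback b q p c ∧ f' ≫ b = f ∧ 𝒮.IsConflation f' q := by
  obtain ⟨V, b, q, hV, hq⟩ := 𝒮.deflation_pullback p c h.deflation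
  have := h.mono
  have hfp : f ≫ p = (0 : X ⟶ W) ≫ c := by rw [h.zero, zero_comp]
  refine ⟨V, b, q, hV.lift f 0 hfp, hV, by simp, of_kernel hq (by simp) ?_ fun T k hk => ?_⟩
  · have : Mono (hV.lift f 0 hfp ≫ b) := by simpa
    exact mono_of_mono _ b
  · obtain ⟨l, hl⟩ := h.exists_lift (k ≫ b)
      (by rw [Category.assoc, hV.w, reassoc_of% hk, zero_comp])
    exact ⟨l, hV.hom_ext (by simpa) (by simp [hk])⟩

theorem exists_pushout (h : 𝒮.IsConflation f p) {A : E} (φ : X ⟶ A) :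
    ∃ (V : E) (b : Y ⟶ V) (i : A ⟶ V) (p' : V ⟶ Z),
      f ≫ b = φ ≫ i ∧ b ≫ p' = p ∧ 𝒮.IsConflation i p' := by
  obtain ⟨V, b, i, hV, hi⟩ := 𝒮.inflation_pushout f φ h.inflation
  have := h.epi
  have hfp : f ≫ p = φ ≫ (0 : A ⟶ Z) := by rw [h.zero, comp_zero]
  refine ⟨V, b, i, hV.desc p 0 hfp, hV.w, by simp, of_cokernel hi (by simp) ?_ fun T k hk => ?_⟩
  · have : Epi (b ≫ hV.desc p 0 hfp) := by simpa
    exact epi_of_epi b _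
  · obtain ⟨l, hl⟩ := h.exists_desc (b ≫ k)
      (by rw [← Category.assoc, hV.w, Category.assoc, hk, comp_zero])
    exact ⟨l, hV.hom_ext (by simpa) (by simp [hk])⟩

/-- Given morphisms of conflations into and out of a conflation `X ⟶ Y ⟶ Z` which are the identity
on `X` and on `Z`, the morphism on the right lifts if and only if the morphism on the left
extends: both conditions say that the resulting composite extension splits. -/
theorem lifts_iff_extends {W A V V' : E} {c : W ⟶ Z} {φ : X ⟶ A} {f' : X ⟶ V} {q : V ⟶ W}
    {b : V ⟶ Y} {i : A ⟶ V'} {p' : V' ⟶ Z} {b' : Y ⟶ V'} (h : 𝒮.IsConflation f' q)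
    (h' : 𝒮.IsConflation i p') (hf : f' ≫ b = f) (hb : b ≫ p = q ≫ c) (hb' : f ≫ b' = φ ≫ i)
    (hp : b' ≫ p' = p) : (∃ s : W ⟶ V', s ≫ p' = c) ↔ ∃ ψ : V ⟶ A, f' ≫ ψ = φ := by
  have := h.epi
  have := h'.mono
  constructor
  · rintro ⟨s, hs⟩
    -- The two morphisms `V ⟶ V'` agree over `Z`, so they differ by a morphism into the kernel `A`.
    obtain ⟨ψ, hψ⟩ := h'.exists_lift (b ≫ b' - q ≫ s) (by simp [hp, hs, hb])
    refine ⟨ψ, ?_⟩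
    rw [← cancel_mono i, Category.assoc, hψ, Preadditive.comp_sub, reassoc_of% hf,
      reassoc_of% h.zero, zero_comp, sub_zero, hb']
  · rintro ⟨ψ, hψ⟩
    obtain ⟨s, hs⟩ := h.exists_desc (b ≫ b' - ψ ≫ i)
      (by rw [Preadditive.comp_sub, reassoc_of% hf, reassoc_of% hψ, hb', sub_self])
    refine ⟨s, ?_⟩
    rw [← cancel_epi q, reassoc_of% hs, Preadditive.sub_comp, Category.assoc, Category.assoc, hp,
      h'.zero, comp_zero, sub_zero, hb]

/-- A pushout extension splits if and only if the morphism extends. -/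
theorem splits_iff_extends {A V' : E} {φ : X ⟶ A} {i : A ⟶ V'} {p' : V' ⟶ Z} {b' : Y ⟶ V'}
    (h : 𝒮.IsConflation f p) (h' : 𝒮.IsConflation i p') (hb' : f ≫ b' = φ ≫ i)
    (hp : b' ≫ p' = p) : (∃ s : Z ⟶ V', s ≫ p' = 𝟙 Z) ↔ ∃ ψ : Y ⟶ A, f ≫ ψ = φ :=
  lifts_iff_extends (b := 𝟙 Y) h h' (by simp) (by simp) hb' hp

theorem exists_section_of_retraction (h : 𝒮.IsConflation f p) {r : Y ⟶ X} (hr : f ≫ r = 𝟙 X) :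
    ∃ s : Z ⟶ Y, s ≫ p = 𝟙 Z := by
  have := h.epi
  obtain ⟨s, hs⟩ := h.exists_desc (𝟙 Y - r ≫ f) (by simp [reassoc_of% hr])
  exact ⟨s, by rw [← cancel_epi p, reassoc_of% hs]; simp [h.zero]⟩

/-- Suppose that every morphism `X ⟶ G` which extends along `f'` also extends along `f''`, where
`f'` and `f''` are the kernels of the pullbacks of `p` along `c'` and `c''`, and that `G` is a
generator. Then `c''` lies in the submodule generated by `c'` modulo the image of `p`. -/
theorem exists_eq_comp_add_comp {G : E} (hG : IsAdditiveGenerator G)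
    {W' W'' V' V'' : E} {c' : W' ⟶ Z} {c'' : W'' ⟶ Z} {f' : X ⟶ V'} {q' : V' ⟶ W'} {b' : V' ⟶ Y}
    {f'' : X ⟶ V''} {q'' : V'' ⟶ W''} {b'' : V'' ⟶ Y}
    (h' : 𝒮.IsConflation f' q') (h'' : 𝒮.IsConflation f'' q'') (hf' : f' ≫ b' = f)
    (hf'' : f'' ≫ b'' = f) (hb' : b' ≫ p = q' ≫ c') (hb'' : b'' ≫ p = q'' ≫ c'')
    (hext : ∀ ψ : V' ⟶ G, ∃ χ : V'' ⟶ G, f'' ≫ χ = f' ≫ ψ) :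
    ∃ (u : W'' ⟶ W') (v : W'' ⟶ Y), c'' = u ≫ c' + v ≫ p := by
  have := h''.epi
  obtain ⟨n, s, r, hsr⟩ := hG V'
  -- Extending each component `s i` and reassembling with `r i` extends `f'` itself along `f''`. The
  -- resulting `t : V'' ⟶ V'` induces `u` on cokernels, and `b'' - t ≫ b'` vanishes on `X` and
  -- yields `v`.
  choose χ hχ using fun i => hext (s i)
  have ht : f'' ≫ (∑ i, χ i ≫ r i) = f' := by
    simp only [Preadditive.comp_sum, reassoc_of% hχ]
    rw [← Preadditive.comp_sum, hsr, Category.comp_id]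
  generalize (∑ i, χ i ≫ r i) = t at ht
  obtain ⟨u, hu⟩ := h''.exists_desc (t ≫ q') (by rw [reassoc_of% ht, h'.zero])
  obtain ⟨v, hv⟩ := h''.exists_desc (b'' - t ≫ b')
    (by rw [Preadditive.comp_sub, reassoc_of% ht, hf', hf'', sub_self])
  refine ⟨u, v, ?_⟩
  rw [← cancel_epi q'', Preadditive.comp_add, reassoc_of% hu, reassoc_of% hv,
    Preadditive.sub_comp, Category.assoc, hb', hb'']
  abel

/-- The submodules generated by morphisms `c : W ⟶ Z` modulo the image of `p` correspond, with
order reversed, to certain submodules of `Hom(X, G)`. -/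
theorem exists_submodule_le_iff (R : Type*) [CommRing R] [Linear R E] (h : 𝒮.IsConflation f p)
    {G : E} (hG : IsAdditiveGenerator G) :
    ∃ L : ∀ W : E, (W ⟶ Z) → Submodule R (X ⟶ G), ∀ ⦃W W' : E⦄ (c : W ⟶ Z) (c' : W' ⟶ Z),
      L W' c' ≤ L W c ↔ ∃ (u : W ⟶ W') (v : W ⟶ Y), c = u ≫ c' + v ≫ p := by
  choose V b q f' hV hf hc using fun (W : E) (c : W ⟶ Z) => h.exists_pullback c
  -- `L W c` consists of the morphisms `X ⟶ G` that extend along the inflation of the pullback by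
  -- `c`.
  refine ⟨fun W c => LinearMap.range (Linear.leftComp R G (f' W c)),
    fun W W' c c' => ⟨fun hle => ?_, ?_⟩⟩
  · exact exists_eq_comp_add_comp hG (hc W' c') (hc W c) (hf W' c') (hf W c) (hV W' c').w
      (hV W c).w fun ψ => hle ⟨ψ, rfl⟩
  · rintro ⟨u, v, huv⟩ _ ⟨ψ, rfl⟩
    have hw : (b W c - q W c ≫ v) ≫ p = (q W c ≫ u) ≫ c' := by
      rw [Preadditive.sub_comp, (hV W c).w, huv]; simp
    refine ⟨(hV W' c').lift _ _ hw ≫ ψ, ?_⟩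
    change f' W c ≫ (hV W' c').lift _ _ hw ≫ ψ = f' W' c' ≫ ψ
    rw [← Category.assoc]
    congr 1
    apply (hV W' c').hom_ext
    · simp [hf, reassoc_of% (hc W c).zero]
    · simp [reassoc_of% (hc W c).zero, (hc W' c').zero]

end IsConflation

theorem Deflation.iso_comp {Y' : E} (e : Y' ≅ Y) (hp : 𝒮.Deflation p) :
    𝒮.Deflation (e.hom ≫ p) := by
  obtain ⟨X, i, w, h⟩ := hp
  refine ⟨X, i ≫ e.inv, by simpa, 𝒮.of_iso ?_ h⟩
  exact ShortComplex.isoMk (Iso.refl _) e.symm (Iso.refl _) (by simp) (by simp)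

end Basic

/-! ### Conflations built from biproducts -/

section Biproducts

variable {E : Type u} [Category.{v} E] [Preadditive E] [HasFiniteBiproducts E]
  {𝒮 : ExactStructure E}

/-- The cokernel `W ⟶ O` of `𝟙 W` is a zero deflation, and its pullback along `0 : Z ⟶ O` is the
projection. -/
theorem deflation_fst (Z W : E) : 𝒮.Deflation (biprod.fst : Z ⊞ W ⟶ Z) := by
  obtain ⟨O, p, w, h⟩ := 𝒮.inflation_id W
  have hp : p = 0 := by simpa using w
  obtain ⟨V, b, q, hV, hq⟩ := 𝒮.deflation_pullback p (0 : Z ⟶ O) ⟨W, _, w, h⟩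
  let e : Z ⊞ W ≅ V :=
    { hom := hV.lift biprod.snd biprod.fst (by simp [hp])
      inv := biprod.lift q b
      hom_inv_id := by ext <;> simp
      inv_hom_id := by apply hV.hom_ext <;> simp }
  have : biprod.fst = e.hom ≫ q := by simp [e]
  rw [this]
  exact Deflation.iso_comp e hq

theorem Deflation.biprod_map_id {Y Z : E} {p : Y ⟶ Z} (hp : 𝒮.Deflation p) (W : E) :
    𝒮.Deflation (biprod.map p (𝟙 W)) := by
  obtain ⟨V, b, q, hV, hq⟩ := 𝒮.deflation_pullback p (biprod.fst : Z ⊞ W ⟶ Z) hp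
  let e : Y ⊞ W ≅ V :=
    { hom := hV.lift biprod.fst (biprod.map p (𝟙 W)) (by simp)
      inv := biprod.lift b (q ≫ biprod.snd)
      hom_inv_id := by ext <;> simp
      inv_hom_id := by
        apply hV.hom_ext
        · simp
        · ext
          · simp [hV.w]
          · simp }
  have : biprod.map p (𝟙 W) = e.hom ≫ q := by simp [e]
  rw [this]
  exact Deflation.iso_comp e hq

theorem Deflation.biprod_desc {Y Z : E} {p : Y ⟶ Z} (hp : 𝒮.Deflation p) {W : E} (c : W ⟶ Z) :
    𝒮.Deflation (biprod.desc p c) := by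
  let e : Z ⊞ W ≅ Z ⊞ W :=
    { hom := biprod.lift (biprod.desc (𝟙 Z) c) biprod.snd
      inv := biprod.lift (biprod.desc (𝟙 Z) (-c)) biprod.snd
      hom_inv_id := by ext <;> simp
      inv_hom_id := by ext <;> simp }
  have : biprod.desc p c = biprod.map p (𝟙 W) ≫ e.hom ≫ biprod.fst := by
    ext <;> simp [e]
  rw [this]
  exact 𝒮.deflation_comp _ _ (hp.biprod_map_id W) (Deflation.iso_comp e (deflation_fst Z W))

variable {X Y Z : E} {f : X ⟶ Y} {p : Y ⟶ Z}

theorem IsConflation.of_isPullback (h : 𝒮.IsConflation f p) {V W : E} {b : V ⟶ Y} {q : V ⟶ W}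
    {c : W ⟶ Z} (hV : IsPullback b q p c) :
    𝒮.IsConflation (biprod.lift b (-q)) (biprod.desc p c) := by
  refine of_kernel (h.deflation.biprod_desc c) (by simp [biprod.lift_desc, hV.w]) ⟨?_⟩ ?_
  · intro T k l hkl
    apply hV.hom_ext
    · simpa using hkl =≫ biprod.fst
    · simpa using hkl =≫ biprod.snd
  · intro T k hk
    have hk' : (k ≫ biprod.fst) ≫ p = (-(k ≫ biprod.snd)) ≫ c := by
      rw [Preadditive.neg_comp, ← add_eq_zero_iff_eq_neg, ← hk, biprod.desc_eq]
      simp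
    exact ⟨hV.lift _ _ hk', by ext <;> simp⟩

/-- A conflation whose deflation has a section is a biproduct. -/
theorem IsConflation.nonempty_iso_biprod (h : 𝒮.IsConflation f p) {s : Z ⟶ Y} (hs : s ≫ p = 𝟙 Z) :
    Nonempty (Y ≅ X ⊞ Z) := by
  have := h.mono
  obtain ⟨r, hr⟩ := h.exists_lift (𝟙 Y - p ≫ s) (by simp [hs])
  have hfr : f ≫ r = 𝟙 X := by
    rw [← cancel_mono f, Category.assoc, hr]; simp [reassoc_of% h.zero]
  have hsr : s ≫ r = 0 := by
    rw [← cancel_mono f, Category.assoc, hr]; simp [reassoc_of% hs]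
  refine ⟨⟨biprod.lift r p, biprod.desc f s, ?_, ?_⟩⟩
  · rw [biprod.lift_desc, hr]; abel
  · ext <;> simp [hfr, hsr, hs, h.zero]

/-- If the deflation of a pushout of a conflation factors through the original deflation, then the
pushout square is split. -/
theorem IsConflation.nonempty_iso_biprod_of_pushout (h : 𝒮.IsConflation f p) {A V : E} {φ : X ⟶ A}
    {i : A ⟶ V} {p' : V ⟶ Z} {b : Y ⟶ V} (h' : 𝒮.IsConflation i p') (hb : f ≫ b = φ ≫ i)
    (hp : b ≫ p' = p) {t : V ⟶ Y} (ht : t ≫ p = p') : Nonempty (Y ⊞ A ≅ X ⊞ V) := by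
  have := h.mono
  have := h'.mono
  -- These are the data splitting `X ⟶ Y ⊞ A ⟶ V`: `(t, u)` is a section of `(b, i)` and `(x, -k)` a
  -- retraction of `(f, -φ)`.
  obtain ⟨u, hu⟩ := h'.exists_lift (𝟙 V - t ≫ b) (by simp [hp, ht])
  obtain ⟨x, hx⟩ := h.exists_lift (𝟙 Y - b ≫ t) (by simp [hp, ht])
  obtain ⟨k, hk⟩ := h.exists_lift (i ≫ t) (by rw [Category.assoc, ht, h'.zero])
  have h₁ : b ≫ u = x ≫ φ := by
    rw [← cancel_mono i, Category.assoc, Category.assoc, hu, ← hb, reassoc_of% hx]; simp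
  have h₂ : i ≫ u = 𝟙 A - k ≫ φ := by
    rw [← cancel_mono i, Category.assoc, hu, Preadditive.sub_comp, Category.assoc, ← hb,
      reassoc_of% hk]
    simp
  have h₃ : f ≫ x = 𝟙 X - φ ≫ k := by
    rw [← cancel_mono f, Category.assoc, hx, Preadditive.sub_comp, Category.assoc, hk,
      ← reassoc_of% hb]
    simp
  have h₄ : t ≫ x = u ≫ k := by
    rw [← cancel_mono f, Category.assoc, Category.assoc, hx, hk, reassoc_of% hu]; simp
  refine ⟨⟨biprod.desc (biprod.lift x b) (biprod.lift (-k) i),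
    biprod.desc (biprod.lift f (-φ)) (biprod.lift t u), ?_, ?_⟩⟩
  · ext <;> simp [hx, hk, h₁, h₂]
  · ext <;> simp [h₃, h₄, hb, hu]

end Biproducts

end ExactStructure

/-! ### The radical and simple cokernels -/

section Radical

variable {E : Type u} [Category.{v} E] [Preadditive E]

/-- Jacobson's formula: with `j` inverse to `𝟙 - b ≫ a`, the inverse sought is `𝟙 + a ≫ j ≫ b`. It
makes the radical left-right symmetric. -/
theorem isIso_one_sub_comp_comm {X Y : E} (a : X ⟶ Y) (b : Y ⟶ X) (h : IsIso (𝟙 Y - b ≫ a)) :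
    IsIso (𝟙 X - a ≫ b) := by
  have h₁ := IsIso.hom_inv_id (𝟙 Y - b ≫ a)
  have h₂ := IsIso.inv_hom_id (𝟙 Y - b ≫ a)
  generalize inv (𝟙 Y - b ≫ a) = j at h₁ h₂
  rw [Preadditive.sub_comp, Category.id_comp, Category.assoc, sub_eq_iff_eq_add] at h₁
  rw [Preadditive.comp_sub, Category.comp_id, sub_eq_iff_eq_add] at h₂
  refine ⟨𝟙 X + a ≫ j ≫ b, ?_, ?_⟩
  · have : a ≫ j ≫ b = a ≫ b + a ≫ b ≫ a ≫ j ≫ b := by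
      conv_lhs => rw [h₁]
      simp
    simp only [Preadditive.sub_comp, Preadditive.comp_add, Category.id_comp, Category.comp_id,
      Category.assoc]
    nth_rw 1 [this]
    abel
  · have : a ≫ j ≫ b = a ≫ b + a ≫ j ≫ b ≫ a ≫ b := by
      conv_lhs => rw [h₂]
      simp
    simp only [Preadditive.comp_sub, Preadditive.add_comp, Category.id_comp, Category.comp_id,
      Category.assoc]
    rw [this]
    abel

/-- In a composite through `C` which is an automorphism of `C ≠ 0`, no morphism is radical. -/
theorem InRadical.not_isIso_comp {C W : E} (hC : ¬ IsZero C) {h : C ⟶ W} (hh : InRadical h)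
    (k : W ⟶ C) : ¬ IsIso (h ≫ k) := by
  intro hiso
  have h₀ := hh (k ≫ inv (h ≫ k))
  rw [← Category.assoc, IsIso.hom_inv_id, sub_self] at h₀
  exact hC ((IsZero.iff_id_eq_zero C).2 (by rw [← IsIso.hom_inv_id (0 : C ⟶ C), zero_comp]))

theorem InRadical.not_isIso_comp' {C W : E} (hC : ¬ IsZero C) {h : W ⟶ C} (hh : InRadical h)
    (k : C ⟶ W) : ¬ IsIso (k ≫ h) := by
  intro hiso
  have h₀ := isIso_one_sub_comp_comm _ _ (hh (inv (k ≫ h) ≫ k))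
  rw [Category.assoc, IsIso.inv_hom_id, sub_self] at h₀
  exact hC ((IsZero.iff_id_eq_zero C).2 (by rw [← IsIso.hom_inv_id (0 : C ⟶ C), zero_comp]))

theorem inRadical_of_not_isIso {C W : E} (hC : IsLocalRing (End C)) {h : C ⟶ W}
    (hh : ∀ k : W ⟶ C, ¬ IsIso (h ≫ k)) : InRadical h := fun k =>
  (isIso_or_isIso_of_add_eq_id hC (add_sub_cancel (h ≫ k) (𝟙 C))).resolve_left (hh k)

theorem inRadical_of_not_isIso' {C W : E} (hC : IsLocalRing (End C)) {h : W ⟶ C}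
    (hh : ∀ k : C ⟶ W, ¬ IsIso (k ≫ h)) : InRadical h := fun k =>
  isIso_one_sub_comp_comm _ _
    ((isIso_or_isIso_of_add_eq_id hC (add_sub_cancel (k ≫ h) (𝟙 C))).resolve_left (hh k))

/-- The cokernel of `E(-, p)` is a simple module. -/
def HasSimpleCokernel {Y Z : E} (p : Y ⟶ Z) : Prop :=
  (¬ ∃ s : Z ⟶ Y, s ≫ p = 𝟙 Z) ∧ ∀ ⦃W : E⦄ (d : W ⟶ Z),
    (∃ t : W ⟶ Y, t ≫ p = d) ∨ ∃ (k : Z ⟶ W) (s : Z ⟶ Y), k ≫ d + s ≫ p = 𝟙 Z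

end Radical

/-! ### From simple cokernels to almost split morphisms -/

section AlmostSplit

variable {E : Type u} [Category.{v} E] [Preadditive E] [HasFiniteBiproducts E]

namespace ExactStructure

variable {𝒮 : ExactStructure E} {X Y Z : E} {f : X ⟶ Y} {p : Y ⟶ Z}

/-- A radical `g` extends along `f` once the pushout along `g` splits. If it did not, simplicity
would make `p'` factor through `p`, giving `𝟙 X = g ≫ k + f ≫ w`. One summand is then invertible,
against `g` being radical or `f` having no retraction. -/
theorem IsConflation.leftAlmostSplit (hloc : ∀ C : E, Indecomposable C → IsLocalRing (End C))
    (h : 𝒮.IsConflation f p) (hp : HasSimpleCokernel p) (hX : Indecomposable X) :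
    LeftAlmostSplit f := by
  have hf (r : Y ⟶ X) : ¬ IsIso (f ≫ r) := fun hr =>
    hp.1 (h.exists_section_of_retraction (r := r ≫ inv (f ≫ r))
      (by rw [← Category.assoc, IsIso.hom_inv_id]))
  refine ⟨hX, inRadical_of_not_isIso (hloc X hX) hf, fun W g hg => ?_⟩
  have := h.mono
  obtain ⟨V, b, i, p', hb, hbp, h'⟩ := h.exists_pushout g
  rw [← h.splits_iff_extends h' hb hbp]
  rcases hp.2 p' with ⟨t, ht⟩ | ⟨k, s, hks⟩
  · exfalso
    obtain ⟨k, hk⟩ := h.exists_lift (i ≫ t) (by rw [Category.assoc, ht, h'.zero])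
    obtain ⟨w, hw⟩ := h.exists_lift (𝟙 Y - b ≫ t) (by simp [hbp, ht])
    have hgk : g ≫ k + f ≫ w = 𝟙 X := by
      rw [← cancel_mono f, Preadditive.add_comp, Category.assoc, Category.assoc, hk, hw,
        ← reassoc_of% hb]
      simp
    rcases isIso_or_isIso_of_add_eq_id (hloc X hX) hgk with h₁ | h₁
    · exact hg.not_isIso_comp hX.1 k h₁
    · exact hf w h₁
  · exact ⟨k + s ≫ b, by simpa [hbp] using hks⟩

theorem rightAlmostSplit_of_hasSimpleCokernel
    (hloc : ∀ C : E, Indecomposable C → IsLocalRing (End C))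
    (hp : HasSimpleCokernel p) (hZ : Indecomposable Z) :
    RightAlmostSplit p := by
  have hp' (r : Z ⟶ Y) : ¬ IsIso (r ≫ p) := fun hr =>
    hp.1 ⟨inv (r ≫ p) ≫ r, by rw [Category.assoc, IsIso.inv_hom_id]⟩
  refine ⟨hZ, inRadical_of_not_isIso' (hloc Z hZ) hp', fun W g hg => ?_⟩
  refine (hp.2 g).resolve_right ?_
  rintro ⟨k, s, hks⟩
  rcases isIso_or_isIso_of_add_eq_id (hloc Z hZ) hks with h₁ | h₁
  · exact hg.not_isIso_comp' hZ.1 k h₁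
  · exact hp' s h₁

end ExactStructure

end AlmostSplit

/-! ### Reduction of conflations to AR conflations -/

section Classes

variable {E : Type u} [Category.{v} E] [Preadditive E] [HasFiniteBiproducts E]

/-- With `g` the identity, this yields an indecomposable on which a non-split deflation fails to
lift. -/
theorem Decomposition.exists_factorization {Y Z Z' : E} {z : SplitK₀ E} (hz : Decomposition Z z)
    (p : Y ⟶ Z') (g : Z ⟶ Z')
    (h : ∀ (C : E), Indecomposable C → ∀ c : C ⟶ Z, ∃ t : C ⟶ Y, t ≫ p = c ≫ g) :
    ∃ t : Z ⟶ Y, t ≫ p = g := by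
  induction hz with
  | zero hZ => exact ⟨0, hZ.eq_of_src _ _⟩
  | cons C e _ ih =>
    obtain ⟨t, ht⟩ := h C.1 C.2 (biprod.inl ≫ e.inv)
    obtain ⟨t', ht'⟩ := ih (biprod.inr ≫ e.inv ≫ g) fun D hD d => by
      obtain ⟨t, ht⟩ := h D hD (d ≫ biprod.inr ≫ e.inv)
      exact ⟨t, by simpa using ht⟩
    refine ⟨e.hom ≫ biprod.desc t t', ?_⟩
    rw [← cancel_epi e.inv]
    ext <;> simp [ht, ht']

theorem Decomposition.exists_extension {X X' Y : E} {x : SplitK₀ E} (hx : Decomposition X x)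
    (f : X' ⟶ Y) (g : X' ⟶ X)
    (h : ∀ (C : E), Indecomposable C → ∀ c : X ⟶ C, ∃ t : Y ⟶ C, f ≫ t = g ≫ c) :
    ∃ t : Y ⟶ X, f ≫ t = g := by
  induction hx with
  | zero hX => exact ⟨0, hX.eq_of_tgt _ _⟩
  | cons C e _ ih =>
    obtain ⟨t, ht⟩ := h C.1 C.2 (e.hom ≫ biprod.fst)
    obtain ⟨t', ht'⟩ := ih (g ≫ e.hom ≫ biprod.snd) fun D hD d => by
      obtain ⟨t, ht⟩ := h D hD (e.hom ≫ biprod.snd ≫ d)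
      exact ⟨t, by simpa using ht⟩
    refine ⟨biprod.lift t t' ≫ e.inv, ?_⟩
    rw [← cancel_mono e.hom]
    ext <;> simp [ht, ht']

variable [IsIdempotentComplete E]

theorem cls_biprod (hloc : ∀ C : E, Indecomposable C → IsLocalRing (End C))
    (hdec : ∀ X : E, ∃ x, Decomposition X x) {X A B : E} (e : X ≅ A ⊞ B) :
    cls X = cls A + cls B := by
  obtain ⟨a, ha⟩ := hdec A
  obtain ⟨b, hb⟩ := hdec B
  rw [ha.cls_eq hloc, hb.cls_eq hloc, (ha.biprod hb e).cls_eq hloc]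

namespace ExactStructure

variable {𝒮 : ExactStructure E} {X Y Z : E} {f : X ⟶ Y} {p : Y ⟶ Z}

/-- Some `φ : X ⟶ D` with `D` indecomposable does not extend to `Y`, so the pushout along it is
non-split. By simplicity `p'` factors through `p`; hence the cokernel is still simple and the
pushout square splits as `Y ⊞ D ≅ X ⊞ V`, leaving the alternating sum unchanged. -/
theorem IsConflation.mem_AR_of_indecomposable_right
    (hloc : ∀ C : E, Indecomposable C → IsLocalRing (End C))
    (hdec : ∀ X : E, ∃ x, Decomposition X x) (h : 𝒮.IsConflation f p)
    (hp : HasSimpleCokernel p) (hZ : Indecomposable Z) : cls X - cls Y + cls Z ∈ 𝒮.AR := by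
  have hX : ∃ (D : E) (_ : Indecomposable D) (φ : X ⟶ D), ¬ ∃ t : Y ⟶ D, f ≫ t = φ := by
    by_contra! hX
    obtain ⟨x, hx⟩ := hdec X
    obtain ⟨t, ht⟩ := hx.exists_extension f (𝟙 X) fun C hC c => by simpa using hX C hC c
    exact hp.1 (h.exists_section_of_retraction ht)
  obtain ⟨D, hD, φ, hφ⟩ := hX
  obtain ⟨V, b, i, p', hb, hbp, h'⟩ := h.exists_pushout φ
  rw [← h.splits_iff_extends h' hb hbp] at hφ
  obtain ⟨t, ht⟩ := (hp.2 p').resolve_right fun ⟨k, s, hks⟩ =>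
    hφ ⟨k + s ≫ b, by simpa [hbp] using hks⟩
  have hp' : HasSimpleCokernel p' := by
    refine ⟨hφ, fun W d => ?_⟩
    rcases hp.2 d with ⟨t', ht'⟩ | ⟨k, s, hks⟩
    · exact Or.inl ⟨t' ≫ b, by simpa [hbp] using ht'⟩
    · exact Or.inr ⟨k, s ≫ b, by simpa [hbp] using hks⟩
  obtain ⟨e⟩ := h.nonempty_iso_biprod_of_pushout h' hb hbp ht
  have h₁ := (cls_biprod hloc hdec (Iso.refl _)).symm.trans (cls_biprod hloc hdec e)
  have h₂ : cls X - cls Y + cls Z = cls D - cls V + cls Z := by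
    rw [eq_sub_of_add_eq h₁]; abel
  rw [h₂]
  exact AddSubgroup.subset_closure ⟨ShortComplex.mk i p' h'.zero,
    ⟨h'.2, h'.leftAlmostSplit hloc hp' hD, rightAlmostSplit_of_hasSimpleCokernel hloc hp' hZ⟩, rfl⟩

/-- Pull back along some `c : C ⟶ Z` with `C` indecomposable that does not factor through `p`.
Simplicity splits `(p, c) : Y ⊞ C ⟶ Z`, so `Y ⊞ C ≅ V ⊞ Z` and the alternating sum is unchanged. -/
theorem IsConflation.mem_AR_of_hasSimpleCokernel
    (hloc : ∀ C : E, Indecomposable C → IsLocalRing (End C))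
    (hdec : ∀ X : E, ∃ x, Decomposition X x) (h : 𝒮.IsConflation f p)
    (hp : HasSimpleCokernel p) : cls X - cls Y + cls Z ∈ 𝒮.AR := by
  have hZ : ∃ (C : E) (_ : Indecomposable C) (c : C ⟶ Z), ¬ ∃ t : C ⟶ Y, t ≫ p = c := by
    by_contra! hZ
    obtain ⟨z, hz⟩ := hdec Z
    exact hp.1 (hz.exists_factorization p (𝟙 Z) fun C hC c => by simpa using hZ C hC c)
  obtain ⟨C, hC, c, hc⟩ := hZ
  obtain ⟨k, s, hks⟩ := (hp.2 c).resolve_left hc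
  obtain ⟨V, b, q, f', hV, hf', h'⟩ := h.exists_pullback c
  have hq : HasSimpleCokernel q := by
    refine ⟨fun ⟨t, ht⟩ => hc ⟨t ≫ b, by rw [Category.assoc, hV.w, reassoc_of% ht]⟩,
      fun W d => ?_⟩
    rcases hp.2 (d ≫ c) with ⟨t, ht⟩ | ⟨k', s', hks'⟩
    · exact Or.inl ⟨hV.lift t d ht, by simp⟩
    · have hw : (c ≫ s') ≫ p = (𝟙 C - c ≫ k' ≫ d) ≫ c := by
        have := c ≫= hks'
        rw [Preadditive.comp_add, Category.comp_id] at this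
        rw [Category.assoc, Preadditive.sub_comp, Category.id_comp, Category.assoc, Category.assoc]
        exact eq_sub_of_add_eq' this
      exact Or.inr ⟨c ≫ k', hV.lift _ _ hw, by simp⟩
  obtain ⟨e⟩ := (h.of_isPullback hV).nonempty_iso_biprod (s := biprod.lift s k)
    (by rw [biprod.lift_desc, add_comm, hks])
  have h₁ := (cls_biprod hloc hdec (Iso.refl _)).symm.trans (cls_biprod hloc hdec e)
  have h₂ : cls X - cls Y + cls Z = cls X - cls V + cls C := by
    rw [eq_sub_of_add_eq h₁]; abel
  rw [h₂]
  exact h'.mem_AR_of_indecomposable_right hloc hdec hq hC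

theorem IsConflation.mem_AR (hloc : ∀ C : E, Indecomposable C → IsLocalRing (End C))
    (hdec : ∀ X : E, ∃ x, Decomposition X x) (R : Type*) [CommRing R] [IsNoetherianRing R]
    [Linear R E] (hNoeth : HomNoetherian R E) {G : E} (hG : IsAdditiveGenerator G)
    (h : 𝒮.IsConflation f p) :
    cls X - cls Y + cls Z ∈ 𝒮.AR := by
  have hn (A : E) : IsNoetherian R (A ⟶ G) := by
    have := hNoeth A G
    infer_instance
  have hn' : IsNoetherian R (G ⟶ Z) := by
    have := hNoeth G Z
    infer_instance
  induction hI : LinearMap.range (Linear.rightComp R G p) using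
    WellFoundedGT.induction generalizing X Y f p with
  | _ I ih =>
  subst hI
  by_cases hp : ∃ s : Z ⟶ Y, s ≫ p = 𝟙 Z
  · obtain ⟨s, hs⟩ := hp
    obtain ⟨e⟩ := h.nonempty_iso_biprod hs
    rw [cls_biprod hloc hdec e]
    convert zero_mem 𝒮.AR using 1
    abel
  obtain ⟨L, hL⟩ := h.exists_submodule_le_iff R hG
  -- Since `L` reverses the order, a maximal value picks a `c` generating a minimal nonzero
  -- submodule of the cokernel.
  obtain ⟨-, ⟨W, c, hc, rfl⟩, hmax⟩ := wellFounded_gt.has_min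
    {N | ∃ (W : E) (c : W ⟶ Z), (¬ ∃ t : W ⟶ Y, t ≫ p = c) ∧ L W c = N} ⟨_, Z, 𝟙 Z, hp, rfl⟩
  obtain ⟨V, b, q, f', hV, hf', h'⟩ := h.exists_pullback c
  have hq : HasSimpleCokernel q := by
    refine ⟨fun ⟨t, ht⟩ => hc ⟨t ≫ b, by rw [Category.assoc, hV.w, reassoc_of% ht]⟩,
      fun W' d => ?_⟩
    by_cases hd : ∃ t : W' ⟶ Y, t ≫ p = d ≫ c
    · obtain ⟨t, ht⟩ := hd
      exact Or.inl ⟨hV.lift t d ht, by simp⟩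
    · have h₁ : L W c ≤ L W' (d ≫ c) := (hL (d ≫ c) c).2 ⟨d, 0, by simp⟩
      have h₂ : L W' (d ≫ c) ≤ L W c := by
        by_contra h₃
        exact hmax _ ⟨W', d ≫ c, hd, rfl⟩ (lt_of_le_not_ge h₁ h₃)
      obtain ⟨u, v, huv⟩ := (hL c (d ≫ c)).1 h₂
      have hw : v ≫ p = (𝟙 W - u ≫ d) ≫ c := by
        rw [Preadditive.sub_comp, Category.id_comp, Category.assoc]
        exact eq_sub_of_add_eq' huv.symm
      exact Or.inr ⟨u, hV.lift _ _ hw, by simp⟩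
  have h₁ := h'.mem_AR_of_hasSimpleCokernel hloc hdec hq
  have h₂ := ih (LinearMap.range (Linear.rightComp R G (biprod.desc p c))) ?_
    (h.of_isPullback hV) rfl
  · rw [cls_biprod hloc hdec (Iso.refl (Y ⊞ W))] at h₂
    convert add_mem h₁ h₂ using 1
    abel
  -- If the image did not grow, every `r i ≫ c` would lift along `p`, and so would `c`.
  · refine lt_of_le_not_ge ?_ fun hle => hc ?_
    · rintro _ ⟨y, rfl⟩
      exact ⟨y ≫ biprod.inl, by simp⟩
    · obtain ⟨n, s, r, hsr⟩ := hG W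
      have hr (i : Fin n) : ∃ y : G ⟶ Y, y ≫ p = r i ≫ c :=
        hle ⟨r i ≫ biprod.inr, by simp⟩
      choose y hy using hr
      refine ⟨∑ i, s i ≫ y i, ?_⟩
      simp only [Preadditive.sum_comp, Category.assoc, hy]
      simp only [← Category.assoc]
      rw [← Preadditive.sum_comp, hsr, Category.id_comp]

theorem AR_eq_Ex (hloc : ∀ C : E, Indecomposable C → IsLocalRing (End C))
    (hdec : ∀ X : E, ∃ x, Decomposition X x) (R : Type*) [CommRing R] [IsNoetherianRing R]
    [Linear R E] (hNoeth : HomNoetherian R E) {G : E} (hG : IsAdditiveGenerator G) :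
    𝒮.AR = 𝒮.Ex := by
  apply le_antisymm
  · exact AddSubgroup.closure_mono fun x ⟨S, hS, hx⟩ => ⟨S, hS.1, hx⟩
  · rw [Ex, AddSubgroup.closure_le]
    rintro x ⟨S, hS, rfl⟩
    exact IsConflation.mem_AR hloc hdec R hNoeth hG ⟨S.zero, hS⟩

end ExactStructure

end Classes

/-! ### Submodules of effaceable modules and finite length -/

section Modules

open Opposite

variable {E : Type u} [Category.{v} E] [Preadditive E]

/-- The morphism of modules `E(-, W) ⟶ N` determined by an element of `N(W)`. -/
def homOfElement (N : Eᵒᵖ ⥤+ AddCommGrpCat.{v}) {W : Eᵒᵖ} (x : N.obj.obj W) :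
    preadditiveYoneda.obj W.unop ⟶ N.obj where
  app V := AddCommGrpCat.ofHom
    { toFun := fun g : V.unop ⟶ W.unop => N.obj.map g.op x
      map_zero' := by
        change N.obj.map (0 : V.unop ⟶ W.unop).op x = 0
        rw [op_zero, Functor.map_zero]
        rfl
      map_add' := fun (g g' : V.unop ⟶ W.unop) => by
        change N.obj.map (g + g').op x = N.obj.map g.op x + N.obj.map g'.op x
        rw [op_add, Functor.map_add]
        rfl }
  naturality V V' k := by
    ext (g : V.unop ⟶ W.unop)
    change N.obj.map (k.unop ≫ g).op x = N.obj.map k (N.obj.map g.op x)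
    rw [op_comp, Functor.map_comp]
    rfl

/-- Monomorphisms of modules are pointwise injective. -/
theorem injective_app_of_mono {N M : Eᵒᵖ ⥤+ AddCommGrpCat.{v}} (i : N ⟶ M) [Mono i] (W : Eᵒᵖ) :
    Function.Injective (i.hom.app W) := by
  intro x y hxy
  let H (x : N.obj.obj W) : AdditiveFunctor.of (preadditiveYoneda.obj W.unop) ⟶ N :=
    ObjectProperty.homMk (homOfElement N x)
  have h : H x ≫ i = H y ≫ i := by
    apply ObjectProperty.hom_ext
    ext V (g : V.unop ⟶ W.unop)
    change i.hom.app V (N.obj.map g.op x) = i.hom.app V (N.obj.map g.op y)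
    have hn (x : N.obj.obj W) : i.hom.app V (N.obj.map g.op x) = M.obj.map g.op (i.hom.app W x) :=
      ConcreteCategory.congr_hom (i.hom.naturality g.op) x
    rw [hn, hn, hxy]
  have h' := congrArg (fun j => j.hom.app W (𝟙 W.unop : W.unop ⟶ W.unop)) ((cancel_mono i).1 h)
  change N.obj.map (𝟙 W.unop).op x = N.obj.map (𝟙 W.unop).op y at h'
  have h'' : N.obj.map (𝟙 W) x = N.obj.map (𝟙 W) y := h'
  rwa [CategoryTheory.Functor.map_id] at h''

/-- The arrow of `N'` is pointwise injective, so the chosen preimages are unique and therefore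
additive and natural. -/
theorem subobject_le_of_forall {M : Eᵒᵖ ⥤+ AddCommGrpCat.{v}} {N N' : Subobject M}
    (h : ∀ (W : Eᵒᵖ) (x : (N : Eᵒᵖ ⥤+ AddCommGrpCat.{v}).obj.obj W),
      ∃ y : (N' : Eᵒᵖ ⥤+ AddCommGrpCat.{v}).obj.obj W, N'.arrow.hom.app W y = N.arrow.hom.app W x) :
    N ≤ N' := by
  choose t ht using h
  have hinj := injective_app_of_mono N'.arrow
  let τ : (N : Eᵒᵖ ⥤+ AddCommGrpCat.{v}) ⟶ (N' : Eᵒᵖ ⥤+ AddCommGrpCat.{v}) :=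
    ObjectProperty.homMk
      { app := fun W => AddCommGrpCat.ofHom (AddMonoidHom.mk' (t W) fun x y => hinj W (by
          rw [map_add, ht, ht, ht, map_add]))
        naturality := fun V W k => by
          ext x
          change t W (_) = (N' : Eᵒᵖ ⥤+ AddCommGrpCat.{v}).obj.map k (t V x)
          apply hinj W
          have h₁ := ConcreteCategory.congr_hom (N'.arrow.hom.naturality k) (t V x)
          have h₂ := ConcreteCategory.congr_hom (N.arrow.hom.naturality k) x
          refine (ht _ _).trans (h₂.trans (Eq.trans ?_ h₁.symm))
          exact congrArg (M.obj.map k) (ht V x).symm }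
  refine Subobject.le_of_comm τ ?_
  apply ObjectProperty.hom_ext
  ext W x
  exact ht W x

theorem exists_isBot_subobject (M : Eᵒᵖ ⥤+ AddCommGrpCat.{v}) : ∃ N : Subobject M, IsBot N := by
  let A : AddCommGrpCat.{v} := AddCommGrpCat.of PUnit
  have hA : IsZero A := AddCommGrpCat.isZero_of_subsingleton A
  have : Functor.Additive ((Functor.const Eᵒᵖ).obj A) := ⟨hA.eq_of_tgt _ _⟩
  let O : Eᵒᵖ ⥤+ AddCommGrpCat.{v} := AdditiveFunctor.of ((Functor.const Eᵒᵖ).obj A)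
  have hO {T : Eᵒᵖ ⥤+ AddCommGrpCat.{v}} (a b : T ⟶ O) : a = b :=
    ObjectProperty.hom_ext _ (NatTrans.ext (funext fun _ => hA.eq_of_tgt _ _))
  have hO' {T : Eᵒᵖ ⥤+ AddCommGrpCat.{v}} (a b : O ⟶ T) : a = b :=
    ObjectProperty.hom_ext _ (NatTrans.ext (funext fun _ => hA.eq_of_src _ _))
  let z (T : Eᵒᵖ ⥤+ AddCommGrpCat.{v}) : O ⟶ T :=
    ObjectProperty.homMk
      { app := fun _ => 0
        naturality := fun _ _ _ => hA.eq_of_src _ _ }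
  have : Mono (z M) := ⟨fun a b _ => hO a b⟩
  exact ⟨Subobject.mk (z M), fun N => Subobject.mk_le_of_comm (z _) (hO' _ _)⟩

section Presentation

variable {M : Eᵒᵖ ⥤+ AddCommGrpCat.{v}} {Z : E} (π : preadditiveYoneda.obj Z ⟶ M.obj)

/-- The element of `M(W)` represented by a morphism `c : W ⟶ Z`. -/
def elementOf {W : E} (c : W ⟶ Z) : M.obj.obj (op W) :=
  π.app (op W) (show (preadditiveYoneda.obj Z).obj (op W) from c)

theorem elementOf_add {W : E} (c d : W ⟶ Z) :
    elementOf π (c + d) = elementOf π c + elementOf π d :=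
  (π.app (op W)).hom.map_add _ _

theorem elementOf_comp {V W : E} (k : V ⟶ W) (c : W ⟶ Z) :
    elementOf π (k ≫ c) = M.obj.map k.op (elementOf π c) :=
  ConcreteCategory.congr_hom (π.naturality k.op) (show (preadditiveYoneda.obj Z).obj (op W) from c)

/-- The element represented by `c` belongs to the submodule `N`. -/
def Represents (N : Subobject M) {W : E} (c : W ⟶ Z) : Prop :=
  ∃ x : (N : Eᵒᵖ ⥤+ AddCommGrpCat.{v}).obj.obj (op W), N.arrow.hom.app (op W) x = elementOf π c

variable {π} {N N' : Subobject M}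

theorem Represents.add {W : E} {c d : W ⟶ Z} (hc : Represents π N c) (hd : Represents π N d) :
    Represents π N (c + d) := by
  obtain ⟨x, hx⟩ := hc
  obtain ⟨y, hy⟩ := hd
  exact ⟨x + y, by rw [elementOf_add, ← hx, ← hy]; exact map_add _ _ _⟩

theorem Represents.comp {V W : E} (k : V ⟶ W) {c : W ⟶ Z} (hc : Represents π N c) :
    Represents π N (k ≫ c) := by
  obtain ⟨x, hx⟩ := hc
  refine ⟨(N : Eᵒᵖ ⥤+ AddCommGrpCat.{v}).obj.map k.op x, ?_⟩
  rw [elementOf_comp, ← hx]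
  exact ConcreteCategory.congr_hom (N.arrow.hom.naturality k.op) x

theorem represents_of_elementOf_eq_zero {W : E} {c : W ⟶ Z} (hc : elementOf π c = 0) :
    Represents π N c := ⟨0, by rw [hc]; exact map_zero _⟩

theorem Represents.mono (h : N ≤ N') {W : E} {c : W ⟶ Z} (hc : Represents π N c) :
    Represents π N' c := by
  obtain ⟨x, hx⟩ := hc
  refine ⟨(Subobject.ofLE N N' h).hom.app (op W) x, hx ▸ ?_⟩
  rw [← Subobject.ofLE_arrow h]
  rfl

theorem subobject_le_iff (hπ : ∀ W, Function.Surjective (π.app W)) :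
    N ≤ N' ↔ ∀ (W : E) (c : W ⟶ Z), Represents π N c → Represents π N' c := by
  refine ⟨fun h W c hc => hc.mono h, fun h => subobject_le_of_forall fun W x => ?_⟩
  obtain ⟨c, hc⟩ := hπ W (N.arrow.hom.app W x)
  obtain ⟨y, hy⟩ := h W.unop c ⟨x, hc.symm⟩
  exact ⟨y, hy.trans hc⟩

variable (π N) in
/-- The morphisms `G ⟶ Z` which represent elements of a submodule. -/
def representing (R : Type*) [CommRing R] [Linear R E] (G : E) : Submodule R (G ⟶ Z) where
  carrier := {c | Represents π N c}
  add_mem' := Represents.add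
  zero_mem' := represents_of_elementOf_eq_zero ((π.app (op G)).hom.map_zero)
  smul_mem' r c hc := by
    have := Represents.comp (r • 𝟙 G) hc
    rwa [Linear.smul_comp, Category.id_comp] at this

/-- Over a noetherian category of finite type, submodules of finitely generated modules are
generated by one element. -/
theorem exists_generating_morphism [HasFiniteBiproducts E] (R : Type*) [CommRing R]
    [IsNoetherianRing R] [Linear R E] (hNoeth : HomNoetherian R E) {G : E}
    (hG : IsAdditiveGenerator G) (N : Subobject M) :
    ∃ (W : E) (c : W ⟶ Z), Represents π N c ∧
      ∀ (V : E) (d : V ⟶ Z), Represents π N d → ∃ u : V ⟶ W, d = u ≫ c := by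
  have := hNoeth G Z
  have : IsNoetherian R (G ⟶ Z) := inferInstance
  obtain ⟨m, g, hg⟩ := Submodule.fg_iff_exists_fin_generating_family.1
    (IsNoetherian.noetherian (representing π N R G))
  have hgN (j : Fin m) : Represents π N (g j) := by
    have : g j ∈ representing π N R G := hg ▸ Submodule.subset_span ⟨j, rfl⟩
    exact this
  have hsum {W : E} {ι : Type} (s : Finset ι) (d : ι → (W ⟶ Z)) (hd : ∀ i, Represents π N (d i)) :
      Represents π N (∑ i ∈ s, d i) :=
    Submodule.sum_mem (representing π N R W) fun i _ => hd i
  -- Finitely many module generators at `G` combine into one morphism from a power of `G`.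
  refine ⟨⨁ fun _ : Fin m => G, biproduct.desc g, ?_, fun V d hd => ?_⟩
  · rw [biproduct.desc_eq]
    exact hsum _ _ fun j => (hgN j).comp _
  · obtain ⟨n, s, r, hsr⟩ := hG V
    have hr (i : Fin n) : ∃ u : G ⟶ ⨁ fun _ : Fin m => G, u ≫ biproduct.desc g = r i ≫ d := by
      have hi : r i ≫ d ∈ representing π N R G := hd.comp (r i)
      rw [← hg, Submodule.mem_span_range_iff_exists_fun] at hi
      obtain ⟨a, ha⟩ := hi
      refine ⟨biproduct.lift fun j => a j • 𝟙 G, ?_⟩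
      rw [biproduct.lift_desc, ← ha]
      simp
    choose u hu using hr
    refine ⟨∑ i, s i ≫ u i, ?_⟩
    simp only [Preadditive.sum_comp, Category.assoc, hu]
    simp only [← Category.assoc]
    rw [← Preadditive.sum_comp, hsr, Category.id_comp]

end Presentation

/-- An effaceable module over a noetherian exact category of finite type has finite length. -/
theorem ExactStructure.admissible [HasFiniteBiproducts E] (𝒮 : ExactStructure E) (R : Type*)
    [CommRing R] [IsNoetherianRing R] [Linear R E] (hNoeth : HomNoetherian R E) {G : E}
    (hG : IsAdditiveGenerator G) : 𝒮.Admissible := by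
  rintro M ⟨Y, Z, p, π, ⟨X, f, w, hS⟩, hπ⟩
  have h : 𝒮.IsConflation f p := ⟨w, hS⟩
  have hsurj W := (hπ W).2
  have hp {V : E} (v : V ⟶ Y) : elementOf π (v ≫ p) = 0 :=
    (hπ (op V)).1.apply_apply_eq_zero (show (preadditiveYoneda.obj Y).obj (op V) from v)
  have hXG : IsNoetherian R (X ⟶ G) := by
    have := hNoeth X G
    infer_instance
  have hGZ : IsNoetherian R (G ⟶ Z) := by
    have := hNoeth G Z
    infer_instance
  obtain ⟨L, hL⟩ := h.exists_submodule_le_iff R hG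
  choose W c hc hgen using exists_generating_morphism (π := π) R hNoeth hG
  -- This order-reversing embedding into submodules of `Hom(X, G)` gives the descending chain
  -- condition; `hle'` gives the ascending one through `Hom(G, Z)`.
  have hle (N N' : Subobject M) : N ≤ N' ↔ L _ (c N') ≤ L _ (c N) := by
    rw [hL, subobject_le_iff hsurj]
    constructor
    · intro hNN'
      obtain ⟨u, hu⟩ := hgen N' _ _ (hNN' _ _ (hc N))
      exact ⟨u, 0, by rw [zero_comp, add_zero, hu]⟩
    · rintro ⟨u, v, huv⟩ V d hd
      obtain ⟨k, rfl⟩ := hgen N _ _ hd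
      rw [huv]
      exact (((hc N').comp u).add (represents_of_elementOf_eq_zero (hp v))).comp k
  have hle' (N N' : Subobject M) :
      N ≤ N' ↔ representing π N R G ≤ representing π N' R G := by
    rw [subobject_le_iff hsurj]
    refine ⟨fun hNN' d hd => hNN' _ d hd, fun hNN' V d hd => ?_⟩
    obtain ⟨n, s, r, hsr⟩ := hG V
    rw [← Category.id_comp d, ← hsr, Preadditive.sum_comp]
    refine Submodule.sum_mem (representing π N' R V) fun i _ => ?_
    rw [Category.assoc]
    exact Represents.comp (s i) (hNN' (hd.comp (r i)))
  have : WellFoundedLT (Subobject M) :=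
    StrictAnti.wellFoundedLT (f := fun N => L _ (c N)) fun N N' hlt =>
      lt_of_le_not_ge ((hle _ _).1 hlt.le) fun h => hlt.not_ge ((hle _ _).2 h)
  have : WellFoundedGT (Subobject M) :=
    StrictMono.wellFoundedGT (f := fun N => representing π N R G) fun N N' hlt =>
      lt_of_le_not_ge ((hle' _ _).1 hlt.le) fun h => hlt.not_ge ((hle' _ _).2 h)
  obtain ⟨N, hN⟩ := exists_isBot_subobject M
  obtain ⟨F, h₀, n, hn, hcov⟩ := exists_covBy_seq_of_wellFoundedLT_wellFoundedGT_of_le (hN ⊤)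
  exact ⟨n, F, h₀ ▸ hN, hn ▸ isTop_top, hcov⟩

end Modules

end ExactCat

theorem corollary4p3
    {R : Type*} [CommRing R] [IsLocalRing R] [IsNoetherianRing R]
    [IsAdicComplete (IsLocalRing.maximalIdeal R) R]
    {E : Type u} [Category.{v} E] [Preadditive E] [Linear R E] [HasFiniteBiproducts E]
    [IsIdempotentComplete E] (hNoeth : ExactCat.HomNoetherian R E)
    (𝒮 : ExactCat.ExactStructure E) (hProj : 𝒮.HasEnoughProjectives)
    (hFin : ExactCat.IsOfFiniteType E) :
    ExactCat.IsKrullSchmidt E ∧ 𝒮.Admissible ∧ 𝒮.AR = 𝒮.Ex := by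
  obtain ⟨G, hG⟩ := hFin.exists_generator
  have := hasBinaryBiproducts_of_finite_biproducts E
  have hloc (C : E) (hC : Indecomposable C) : IsLocalRing (End C) :=
    ExactCat.isLocalRing_end_of_indecomposable R hNoeth hC
  have hdec := ExactCat.exists_decomposition R hNoeth hG
  refine ⟨fun X => ?_, 𝒮.admissible R hNoeth hG,
    ExactCat.ExactStructure.AR_eq_Ex hloc hdec R hNoeth hG⟩
  obtain ⟨x, hx⟩ := hdec X
  obtain ⟨n, Y, e, -⟩ := ExactCat.hasClass_iff_decomposition.2 hx
  exact ⟨n, fun i => (Y i).1, fun i => hloc _ (Y i).2, e⟩
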